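/- **Theorem (scalar harmonics on $S^n$).** Let $n\ge 1$, let $S^n$ be the unit sphere in $\mathbb R^{n+1}$ with its round metric, Laplace–Beltrami operator $\hat\triangle$ and surface measure $d^n\Omega$, and let $\Omega^A$ ($A=1,\dots,n+1$) be the Cartesian coordinates of $\Omega\in S^n$. For $\ell\ge 0$ and a constant complex tensor $\boldsymbol a=(a_{A_1\cdots A_\ell})$ put $$Y_{\boldsymbol a}(\Omega)=a_{A_1\cdots A_\ell}\,\Omega^{A_1}\cdots\Omega^{A_\ell}.$$ Call a tensor of rank $\ell$ symmetric if $a_{A_1\cdots A_\ell}=a_{(A_1\cdots A_\ell)}$, and traceless if $a_{A_1\cdots A_{\ell-2}}{}^{B}{}_{B}=0$ (no condition for $\ell\le 1$). A harmonic function with eigenvalue $k^2$ is a smooth $f:S^n\to\mathbb C$ with $(\hat\triangle+k^2)f=0$. 1. The function $Y_{\boldsymbol a}$ depends only on the symmetric part $a_{(A_1\cdots A_\ell)}$ of $\boldsymbol a$, and $Y_{\boldsymbol a}$ is a harmonic function with eigenvalue $k^2=\ell(\ell+n-1)$ if and only if this symmetric part is traceless. In particular, for symmetric $\boldsymbol a$,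 $Y_{\boldsymbol a}$ is a harmonic function with this eigenvalue if and only if $\boldsymbol a$ is traceless. 2. The functions $Y_{\boldsymbol a}$, with $\ell\ge 0$ and $\boldsymbol a$ symmetric and traceless of rank $\ell$, are complete in $L^2(S^n)$: their linear span is dense, and every $f\in L^2(S^n)$ has a unique expansion $f=\sum_{\ell\ge0}Y_{\boldsymbol a_\ell}$, convergent in $L^2(S^n)$, with $\boldsymbol a_\ell$ symmetric and traceless of rank $\ell$. For symmetric traceless $\boldsymbol a,\boldsymbol a'$, the functions $Y_{\boldsymbol a}$ and $Y_{\boldsymbol a'}$ are orthogonal in $L^2(S^n)$ if their ranks differ, and if both have rank $\ell$ then $$\int d^n\Omega\;\overline{Y_{\boldsymbol a}}\,Y_{\boldsymbol a'}=C(n,\ell)\,\bar a^{A_1\cdots A_\ell}a'_{A_1\cdots A_\ell},\qquad C(n,\ell)=\frac{2\pi^{\frac{n+1}{2}}\,\ell!}{2^{\ell}\,\Gamma\!\left(\frac{n+1}{2}+\ell\right)}.$$ 3. For $(n,\ell)\ne(1,0)$ the multiplicity of the eigenvalue $\ell(\ell+n-1)$, i.e. the complex dimension of the space of all harmonic functions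 with this eigenvalue, is $$\frac{(n+2\ell-1)\,(n+\ell-2)!}{(n-1)!\,\ell!};$$ for $(n,\ell)=(1,0)$ it is $1$. -/

import Mathlib

open MeasureTheory Module
open scoped Manifold ContDiff Nat

noncomputable section

namespace SphereHarmonics

/-- The Euclidean space containing the unit sphere of dimension `n`. -/
abbrev Ambient (n : ℕ) : Type := EuclideanSpace ℝ (Fin (n + 1))

/-- The unit `n`-sphere; the coordinates of `Ω : Sph n` are `(Ω : Ambient n) A`. -/
abbrev Sph (n : ℕ) : Type := Metric.sphere (0 : Ambient n) 1

/-! ### The Laplace-Beltrami operator in local coordinates -/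

section Coordinates

variable {n : ℕ} {E F : Type*} [NormedAddCommGroup E] [InnerProductSpace ℝ E]
  [NormedAddCommGroup F] [NormedSpace ℝ F]

/-- The partial derivative `∂ᵢ u` on `ℝⁿ`. -/
def pd (i : Fin n) (u : EuclideanSpace ℝ (Fin n) → F) (y : EuclideanSpace ℝ (Fin n)) : F :=
  fderiv ℝ u y (EuclideanSpace.single i 1)

/-- The metric `γᵢⱼ = ⟨∂ᵢψ, ∂ⱼψ⟩` induced by a local parametrization `ψ`. -/
def metric (ψ : EuclideanSpace ℝ (Fin n) → E) (y : EuclideanSpace ℝ (Fin n)) :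
    Matrix (Fin n) (Fin n) ℝ :=
  Matrix.of fun i j => inner ℝ (pd i ψ y) (pd j ψ y)

/-- The Christoffel symbols `Γᵏᵢⱼ = ½ γᵏˡ (∂ᵢ γⱼₗ + ∂ⱼ γᵢₗ - ∂ₗ γᵢⱼ)` of the Levi-Civita
connection of the induced metric. -/
def christoffel (ψ : EuclideanSpace ℝ (Fin n) → E) (k i j : Fin n)
    (y : EuclideanSpace ℝ (Fin n)) : ℝ :=
  (1 / 2) * ∑ l, (metric ψ y)⁻¹ k l *
    (pd i (fun z => metric ψ z j l) y + pd j (fun z => metric ψ z i l) y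
      - pd l (fun z => metric ψ z i j) y)

/-- The covariant Hessian `Dᵢ Dⱼ u = ∂ᵢ ∂ⱼ u - Γᵏᵢⱼ ∂ₖ u`. -/
def hessian (ψ : EuclideanSpace ℝ (Fin n) → E) (u : EuclideanSpace ℝ (Fin n) → F)
    (i j : Fin n) (y : EuclideanSpace ℝ (Fin n)) : F :=
  pd i (pd j u) y - ∑ k, christoffel ψ k i j y • pd k u y

/-- The Laplace-Beltrami operator `γⁱʲ Dᵢ Dⱼ u` in the coordinates given by `ψ`. -/
def coordLaplacian (ψ : EuclideanSpace ℝ (Fin n) → E) (u : EuclideanSpace ℝ (Fin n) → F)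
    (y : EuclideanSpace ℝ (Fin n)) : F :=
  ∑ i, ∑ j, (metric ψ y)⁻¹ i j • hessian ψ u i j y

end Coordinates

/-- The Laplace-Beltrami operator of the round unit sphere (with the metric induced by the
ambient Euclidean space), computed at `p` in the preferred chart at `p` of the smooth
manifold structure. -/
def laplacian {n : ℕ} (f : Sph n → ℂ) (p : Sph n) : ℂ :=
  coordLaplacian
    (fun y => (((chartAt (EuclideanSpace ℝ (Fin n)) p).symm y : Sph n) : Ambient n))
    (fun y => f ((chartAt (EuclideanSpace ℝ (Fin n)) p).symm y))
    (chartAt (EuclideanSpace ℝ (Fin n)) p p)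

section Linearity

variable {n : ℕ}

lemma pd_add {u v : EuclideanSpace ℝ (Fin n) → ℂ} {y : EuclideanSpace ℝ (Fin n)} (i : Fin n)
    (hu : DifferentiableAt ℝ u y) (hv : DifferentiableAt ℝ v y) :
    pd i (u + v) y = pd i u y + pd i v y := by
  simp [pd, fderiv_add hu hv]

lemma pd_smul {u : EuclideanSpace ℝ (Fin n) → ℂ} (c : ℂ) {y : EuclideanSpace ℝ (Fin n)}
    (i : Fin n) (hu : DifferentiableAt ℝ u y) :
    pd i (c • u) y = c • pd i u y := by
  simp [pd, fderiv_const_smul hu c]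

lemma differentiableAt_pd {u : EuclideanSpace ℝ (Fin n) → ℂ} {y : EuclideanSpace ℝ (Fin n)}
    (i : Fin n) (hu : ContDiffAt ℝ ∞ u y) : DifferentiableAt ℝ (pd i u) y := by
  have h : ContDiffAt ℝ 1 (fderiv ℝ u) y := hu.fderiv_right (m := 1) (by norm_cast)
  exact (h.differentiableAt (by norm_num)).clm_apply (differentiableAt_const _)

lemma eventually_differentiableAt {u : EuclideanSpace ℝ (Fin n) → ℂ}
    {y : EuclideanSpace ℝ (Fin n)} (hu : ContDiffAt ℝ ∞ u y) :
    ∀ᶠ z in nhds y, DifferentiableAt ℝ u z := by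
  have h1 : ContDiffAt ℝ 1 u y := hu.of_le (by norm_cast)
  filter_upwards [h1.eventually (by simp)] with z hz
  exact hz.differentiableAt (by norm_num)

lemma hessian_add {E : Type*} [NormedAddCommGroup E] [InnerProductSpace ℝ E]
    (ψ : EuclideanSpace ℝ (Fin n) → E) {u v : EuclideanSpace ℝ (Fin n) → ℂ}
    {y : EuclideanSpace ℝ (Fin n)} (hu : ContDiffAt ℝ ∞ u y) (hv : ContDiffAt ℝ ∞ v y)
    (i j : Fin n) : hessian ψ (u + v) i j y = hessian ψ u i j y + hessian ψ v i j y := by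
  have h : pd j (u + v) =ᶠ[nhds y] pd j u + pd j v := by
    filter_upwards [eventually_differentiableAt hu, eventually_differentiableAt hv] with z h1 h2
    exact pd_add j h1 h2
  have h2 : pd i (pd j (u + v)) y = pd i (pd j u) y + pd i (pd j v) y := by
    rw [← pd_add i (differentiableAt_pd j hu) (differentiableAt_pd j hv)]
    simp only [pd] at h ⊢
    rw [h.fderiv_eq]
  simp only [hessian, h2, pd_add _ (eventually_differentiableAt hu).self_of_nhds
    (eventually_differentiableAt hv).self_of_nhds, smul_add, Finset.sum_add_distrib]
  ring

lemma hessian_smul {E : Type*} [NormedAddCommGroup E] [InnerProductSpace ℝ E]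
    (ψ : EuclideanSpace ℝ (Fin n) → E) {u : EuclideanSpace ℝ (Fin n) → ℂ} (c : ℂ)
    {y : EuclideanSpace ℝ (Fin n)} (hu : ContDiffAt ℝ ∞ u y)
    (i j : Fin n) : hessian ψ (c • u) i j y = c • hessian ψ u i j y := by
  have h : pd j (c • u) =ᶠ[nhds y] c • pd j u := by
    filter_upwards [eventually_differentiableAt hu] with z h1
    exact pd_smul c j h1
  have h2 : pd i (pd j (c • u)) y = c • pd i (pd j u) y := by
    rw [← pd_smul c i (differentiableAt_pd j hu)]
    simp only [pd] at h ⊢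
    rw [h.fderiv_eq]
  simp only [hessian, h2, pd_smul c _ (eventually_differentiableAt hu).self_of_nhds, smul_sub,
    Finset.smul_sum]
  congr 1
  exact Finset.sum_congr rfl fun k _ => smul_comm _ _ _

lemma contDiffAt_chart {f : Sph n → ℂ} (hf : ContMDiff (𝓡 n) 𝓘(ℝ, ℂ) ∞ f) (p : Sph n) :
    ContDiffAt ℝ ∞ (fun y => f ((chartAt (EuclideanSpace ℝ (Fin n)) p).symm y))
      (chartAt (EuclideanSpace ℝ (Fin n)) p p) := by
  rw [← contMDiffAt_iff_contDiffAt]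
  have h := (contMDiffOn_chart_symm (I := 𝓡 n) (n := ∞) (x := p)).contMDiffAt
    ((chartAt (EuclideanSpace ℝ (Fin n)) p).open_target.mem_nhds
      (mem_chart_target (EuclideanSpace ℝ (Fin n)) p))
  exact (hf _).comp _ h

lemma laplacian_add {f g : Sph n → ℂ} (hf : ContMDiff (𝓡 n) 𝓘(ℝ, ℂ) ∞ f)
    (hg : ContMDiff (𝓡 n) 𝓘(ℝ, ℂ) ∞ g) (p : Sph n) :
    laplacian (f + g) p = laplacian f p + laplacian g p := by
  have h := hessian_add
    (fun y => (((chartAt (EuclideanSpace ℝ (Fin n)) p).symm y : Sph n) : Ambient n))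
    (contDiffAt_chart hf p) (contDiffAt_chart hg p)
  simp only [laplacian, coordLaplacian, ← Finset.sum_add_distrib, ← smul_add]
  exact Finset.sum_congr rfl fun i _ => Finset.sum_congr rfl fun j _ => by rw [← h]; rfl

lemma laplacian_smul {f : Sph n → ℂ} (c : ℂ) (hf : ContMDiff (𝓡 n) 𝓘(ℝ, ℂ) ∞ f)
    (p : Sph n) : laplacian (c • f) p = c • laplacian f p := by
  have h := hessian_smul
    (fun y => (((chartAt (EuclideanSpace ℝ (Fin n)) p).symm y : Sph n) : Ambient n))
    c (contDiffAt_chart hf p)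
  simp only [laplacian, coordLaplacian, Finset.smul_sum]
  refine Finset.sum_congr rfl fun i _ => Finset.sum_congr rfl fun j _ => ?_
  rw [smul_comm, ← h]; rfl

end Linearity

/-- The space of scalar harmonics with eigenvalue `k²`: the smooth complex functions `f` on the
sphere with `(Δ + k²) f = 0`. -/
def eigenspace (n : ℕ) (k2 : ℝ) : Submodule ℂ (Sph n → ℂ) where
  carrier := {f | ContMDiff (𝓡 n) 𝓘(ℝ, ℂ) ∞ f ∧ ∀ p, laplacian f p + (k2 : ℂ) * f p = 0}
  add_mem' := by
    rintro f g ⟨hf, hf2⟩ ⟨hg, hg2⟩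
    refine ⟨hf.add hg, fun p => ?_⟩
    rw [laplacian_add hf hg, Pi.add_apply]
    linear_combination hf2 p + hg2 p
  zero_mem' := by
    have h0 : ContMDiff (𝓡 n) 𝓘(ℝ, ℂ) ∞ (0 : Sph n → ℂ) := contMDiff_const
    refine ⟨h0, fun p => ?_⟩
    have h := laplacian_smul 0 h0 p
    rw [zero_smul, zero_smul] at h
    simp [h]
  smul_mem' := by
    rintro c f ⟨hf, hf2⟩
    have h1 : ContDiff ℝ ∞ (fun z : ℂ => c * z) := contDiff_const.mul contDiff_id
    refine ⟨h1.contMDiff.comp hf, fun p => ?_⟩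
    rw [laplacian_smul c hf, Pi.smul_apply, smul_eq_mul, smul_eq_mul]
    linear_combination c * hf2 p

/-! ### Constant tensors and the functions `Y_a` -/

/-- Complex tensors `a_{A₁…A_ℓ}` on the ambient space, with indices in `Fin (n + 1)`. -/
abbrev Tensor (n ℓ : ℕ) : Type := (Fin ℓ → Fin (n + 1)) → ℂ

variable {n : ℕ}

/-- `a_{A₁…A_ℓ}` is invariant under all permutations of its indices. -/
def IsSymm {ℓ : ℕ} (a : Tensor n ℓ) : Prop :=
  ∀ (σ : Equiv.Perm (Fin ℓ)) (I : Fin ℓ → Fin (n + 1)), a (I ∘ σ) = a I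

/-- The symmetric part `a_{(A₁…A_ℓ)}`. -/
def symmPart {ℓ : ℕ} (a : Tensor n ℓ) : Tensor n ℓ :=
  fun I => (ℓ ! : ℂ)⁻¹ * ∑ σ : Equiv.Perm (Fin ℓ), a (I ∘ σ)

/-- The contraction `a_{A₁…A_m}{}^B{}_B` of the last two indices vanishes; no condition
for tensors of rank `0` and `1`. -/
def IsTraceless : {ℓ : ℕ} → Tensor n ℓ → Prop
  | 0, _ => True
  | 1, _ => True
  | m + 2, a => ∀ J : Fin m → Fin (n + 1), ∑ B : Fin (n + 1), a (Fin.append J ![B, B]) = 0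

/-- The contraction `ā^{A₁…A_ℓ} a'_{A₁…A_ℓ}`. -/
def contract {ℓ : ℕ} (a a' : Tensor n ℓ) : ℂ := ∑ I, starRingEnd ℂ (a I) * a' I

/-- `Y_a(Ω) = a_{A₁…A_ℓ} Ω^{A₁} ⋯ Ω^{A_ℓ}`. -/
def Y {ℓ : ℕ} (a : Tensor n ℓ) (Ω : Sph n) : ℂ :=
  ∑ I : Fin ℓ → Fin (n + 1), a I * ∏ k, (((Ω : Ambient n) (I k) : ℝ) : ℂ)

lemma continuous_Y {ℓ : ℕ} (a : Tensor n ℓ) : Continuous (Y a) := by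
  unfold Y
  fun_prop

/-- The surface measure of the unit sphere. -/
abbrev surfaceMeasure (n : ℕ) : Measure (Sph n) := (volume : Measure (Ambient n)).toSphere

/-- `Y_a` as an element of `L²(Sⁿ)`. -/
def YL2 {ℓ : ℕ} (a : Tensor n ℓ) : Lp ℂ 2 (surfaceMeasure n) :=
  ContinuousMap.toLp 2 (surfaceMeasure n) ℂ ⟨Y a, continuous_Y a⟩

/-- The constant `C(n,ℓ)`. -/
def C (n ℓ : ℕ) : ℝ :=
  2 * Real.pi ^ (((n : ℝ) + 1) / 2) * (ℓ ! : ℝ) /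
    (2 ^ ℓ * Real.Gamma (((n : ℝ) + 1) / 2 + ℓ))

end SphereHarmonics

end

/-!
Let `F` be an ambient function with `F (t x) = t ^ ℓ F x` on a ray through a point `p` of the
sphere. Stereographic coordinates centred at `p` are odd up to an ambient reflection, so at the
origin the metric is the identity and the Christoffel symbols vanish; the Laplace-Beltrami operator
is there the plain sum of second derivatives, and the chain rule gives
`Δ_S F = Δ F - ℓ (ℓ + n - 1) F` at `p` (`laplacian_restrict_of_homogeneous`). For
`F = a_{A₁…A_ℓ} x^{A₁} ⋯ x^{A_ℓ}` with symmetric `a` the ambient Laplacian is `ℓ (ℓ - 1)` times the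
polynomial of the trace of `a`, and a symmetric tensor is determined by its polynomial on the sphere
(`eq_zero_of_Y_eq_zero`), which characterizes the harmonic `Y_a`.

Integrals over the sphere come from Gaussian integrals in polar coordinates. Integrating
`∫ Y_a Y_{a'} exp (-|x|²)` by parts moves one factor `x` of `Y_a` onto `Y_{a'}` as a derivative; the
terms in which the derivative hits `Y_a` are traces and vanish. Induction on the rank gives both the
orthogonality of different ranks (`gaussPair_eq_zero_of_lt`) and the constant `C(n,ℓ)`
(`gaussPair_eq`).

The products with the metric are orthogonal to the traceless tensors, so counting dimensions
splits every symmetric tensor into a traceless one and a product with the metric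
(`symTensors_splitting`). As `|Ω|² = 1`, all polynomial functions on the sphere are therefore sums
of harmonic `Y_a`; these are dense by Stone-Weierstrass, and the spaces of fixed rank form a Hilbert
sum. The splitting also yields the dimension of the traceless symmetric tensors.

For the multiplicity, no eigenfunctions other than the `Y_a` may occur. The Laplace-Beltrami
operator is symmetric on all smooth functions (`integral_mul_laplacian_comm`): one extends the
functions to be constant on rays and integrates by parts in the ambient space against a radial
cutoff, whose gradient is orthogonal to those of the extensions. Hence an eigenfunction with
eigenvalue `ℓ (ℓ + n - 1)` is orthogonal to all `Y_b` of other ranks, and its expansion has a single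
term.
-/

noncomputable section

namespace SphereHarmonics

open InnerProductSpace Topology Filter

/-! ### The Laplace-Beltrami operator of the sphere in ambient terms -/

section Chart

variable {n : ℕ}

/-- The inverse stereographic projection centred at `p`, in the coordinates of the tangent
hyperplane given by the linear isometry `L`. -/
def invStereo (L : EuclideanSpace ℝ (Fin n) →ₗᵢ[ℝ] Ambient n) (p : Ambient n)
    (y : EuclideanSpace ℝ (Fin n)) : Ambient n :=
  (‖y‖ ^ 2 + 4)⁻¹ • ((4 : ℝ) • L y + (4 - ‖y‖ ^ 2) • p)

/-- The preferred chart at `p` projects from `-p`, hence the signs in `invStereo`. -/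
lemma exists_chartAt_symm_eq_invStereo (p : Sph n) :
    ∃ L : EuclideanSpace ℝ (Fin n) →ₗᵢ[ℝ] Ambient n,
      (∀ y, inner ℝ (p : Ambient n) (L y) = 0) ∧
      ∀ y, (((chartAt (EuclideanSpace ℝ (Fin n)) p).symm y : Sph n) : Ambient n)
        = invStereo L p y := by
  have := Fact.mk (@finrank_euclideanSpace_fin ℝ _ (n + 1))
  let U : (Submodule.span ℝ {((-p : Sph n) : Ambient n)})ᗮ ≃ₗᵢ[ℝ] EuclideanSpace ℝ (Fin n) :=
    (OrthonormalBasis.fromOrthogonalSpanSingleton n (ne_zero_of_mem_unit_sphere (-p))).repr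
  refine ⟨(Submodule.subtypeₗᵢ _).comp U.symm.toLinearIsometry, fun y => ?_, fun y => ?_⟩
  · have h : inner ℝ (-(p : Ambient n)) (U.symm y : Ambient n) = 0 :=
      Submodule.mem_orthogonal_singleton_iff_inner_right.mp (U.symm y).2
    rw [inner_neg_left, neg_eq_zero] at h
    exact h
  · have h := stereographic'_symm_apply (n := n) (-p) y
    have hn : ‖(U.symm y : Ambient n)‖ = ‖y‖ := by
      rw [← Submodule.coe_norm, U.symm.norm_map]
    refine h.trans ?_
    change (‖(U.symm y : Ambient n)‖ ^ 2 + 4)⁻¹ • (4 : ℝ) • (U.symm y : Ambient n) +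
      (‖(U.symm y : Ambient n)‖ ^ 2 + 4)⁻¹ • (‖(U.symm y : Ambient n)‖ ^ 2 - 4) •
        ((-p : Sph n) : Ambient n) = (‖y‖ ^ 2 + 4)⁻¹ • ((4 : ℝ) • (U.symm y : Ambient n)
          + (4 - ‖y‖ ^ 2) • (p : Ambient n))
    have hp : ((-p : Sph n) : Ambient n) = -(p : Ambient n) := rfl
    rw [hn, smul_add]
    congr 2
    exact (congrArg _ hp).trans (by rw [smul_neg, ← neg_smul, neg_sub])

lemma chartAt_self_eq_zero (p : Sph n) : chartAt (EuclideanSpace ℝ (Fin n)) p p = 0 := by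
  have := Fact.mk (@finrank_euclideanSpace_fin ℝ _ (n + 1))
  change stereographic' n (-p) p = 0
  refine (congrArg (OrthonormalBasis.fromOrthogonalSpanSingleton n
    (ne_zero_of_mem_unit_sphere (-p))).repr ?_).trans (map_zero _)
  exact stereographic_neg_apply p

lemma contDiff_invStereo (L : EuclideanSpace ℝ (Fin n) →ₗᵢ[ℝ] Ambient n) (p : Ambient n) {k : ℕ∞ω} :
    ContDiff ℝ k (invStereo L p) := by
  have h₀ : ContDiff ℝ k fun w : EuclideanSpace ℝ (Fin n) => ‖w‖ ^ 2 := contDiff_norm_sq ℝ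
  have h₁ : ContDiff ℝ k fun w : EuclideanSpace ℝ (Fin n) => (‖w‖ ^ 2 + 4)⁻¹ :=
    (h₀.add contDiff_const).inv fun x => by positivity
  have h₂ : ContDiff ℝ k fun w : EuclideanSpace ℝ (Fin n) => (4 : ℝ) • L w + (4 - ‖w‖ ^ 2) • p :=
    (L.contDiff.const_smul (4 : ℝ)).add ((contDiff_const.sub h₀).smul contDiff_const)
  exact h₁.smul h₂

/-- The derivative of an even function vanishes at the origin. -/
lemma fderiv_zero_of_even {E F : Type*} [NormedAddCommGroup E] [NormedSpace ℝ E]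
    [NormedAddCommGroup F] [NormedSpace ℝ F] {g : E → F} (hg : ∀ y, g (-y) = g y) :
    fderiv ℝ g 0 = 0 := by
  have h : fderiv ℝ (g ∘ LinearIsometryEquiv.neg ℝ (E := E)) 0
      = (fderiv ℝ g (LinearIsometryEquiv.neg ℝ (E := E) 0)).comp
        ((LinearIsometryEquiv.neg ℝ (E := E)).toContinuousLinearEquiv : E →L[ℝ] E) :=
    (LinearIsometryEquiv.neg ℝ (E := E)).toContinuousLinearEquiv.comp_right_fderiv
  have h2 : g ∘ LinearIsometryEquiv.neg ℝ (E := E) = g := funext fun y => hg y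
  rw [h2] at h
  ext v
  have h3 := congrArg (fun T => T v) h
  simp only [map_zero, ContinuousLinearMap.comp_apply] at h3
  have h4 : fderiv ℝ g 0 v = - fderiv ℝ g 0 v := by
    conv_lhs => rw [h3]
    simp
  have h5 : (2 : ℝ) • fderiv ℝ g 0 v = 0 := by rw [two_smul]; nth_rw 2 [h4]; simp
  simpa using h5

lemma pd_zero_of_even {g : EuclideanSpace ℝ (Fin n) → ℝ} (hg : ∀ y, g (-y) = g y) (i : Fin n) :
    pd i g 0 = 0 := by
  simp [pd, fderiv_zero_of_even hg]

/-- Stereographic coordinates are odd up to the reflection in the axis through `p`, so the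
metric is even in them. -/
lemma metric_invStereo_neg {L : EuclideanSpace ℝ (Fin n) →ₗᵢ[ℝ] Ambient n} {p : Ambient n}
    (hL : ∀ y, inner ℝ p (L y) = 0) (y : EuclideanSpace ℝ (Fin n)) (i j : Fin n) :
    metric (invStereo L p) (-y) i j = metric (invStereo L p) y i j := by
  let R : Ambient n ≃ₗᵢ[ℝ] Ambient n := (Submodule.span ℝ {p}).reflection
  have hRp : R p = p :=
    Submodule.reflection_mem_subspace_eq_self (Submodule.mem_span_singleton_self p)
  have hRL : ∀ y, R (L y) = - L y := fun y =>
    Submodule.reflection_mem_subspace_orthogonalComplement_eq_neg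
      (Submodule.mem_orthogonal_singleton_iff_inner_right.mpr (hL y))
  have hψ : invStereo L p ∘ LinearIsometryEquiv.neg ℝ = R ∘ invStereo L p := by
    funext z
    simp [invStereo, map_add, hRp, hRL]
  have hpd : ∀ i : Fin n, pd i (invStereo L p) (-y) = - R (pd i (invStereo L p) y) := by
    intro i
    have h1 : fderiv ℝ (invStereo L p ∘ LinearIsometryEquiv.neg ℝ) y
      = (fderiv ℝ (invStereo L p) (-y)).comp
        ((LinearIsometryEquiv.neg ℝ
          (E := EuclideanSpace ℝ (Fin n))).toContinuousLinearEquiv :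
          EuclideanSpace ℝ (Fin n) →L[ℝ] EuclideanSpace ℝ (Fin n)) :=
      (LinearIsometryEquiv.neg ℝ
        (E := EuclideanSpace ℝ (Fin n))).toContinuousLinearEquiv.comp_right_fderiv
    rw [hψ, R.comp_fderiv] at h1
    have h2 := congrArg (fun T => T (EuclideanSpace.single i 1)) h1
    simp only [ContinuousLinearMap.comp_apply] at h2
    simp only [pd]
    change R _ = fderiv ℝ (invStereo L p) (-y) (-(EuclideanSpace.single i 1)) at h2
    rw [h2, map_neg, neg_neg]
  simp only [metric, Matrix.of_apply, hpd, inner_neg_neg, R.inner_map_map]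

lemma norm_smul_single_sq (i : Fin n) (t : ℝ) :
    ‖t • EuclideanSpace.single i (1 : ℝ)‖ ^ 2 = t ^ 2 := by
  rw [norm_smul, PiLp.norm_single]
  simp

lemma invStereo_smul_single (L : EuclideanSpace ℝ (Fin n) →ₗᵢ[ℝ] Ambient n) (p : Ambient n)
    (i : Fin n) (t : ℝ) :
    invStereo L p (t • EuclideanSpace.single i 1) =
      (4 * t / (t ^ 2 + 4)) • L (EuclideanSpace.single i 1)
        + ((4 - t ^ 2) / (t ^ 2 + 4)) • p := by
  rw [invStereo, norm_smul_single_sq, map_smul, smul_add, smul_smul, smul_smul, smul_smul]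
  congr 2 <;> ring

/-- The velocity of a coordinate line of stereographic coordinates. -/
def lineVelocity (b p : Ambient n) (t : ℝ) : Ambient n :=
  ((16 - 4 * t ^ 2) / (t ^ 2 + 4) ^ 2) • b + (-16 * t / (t ^ 2 + 4) ^ 2) • p

lemma hasDerivAt_invStereo_line (L : EuclideanSpace ℝ (Fin n) →ₗᵢ[ℝ] Ambient n)
    (p : Ambient n) (i : Fin n) (t : ℝ) :
    HasDerivAt (fun s : ℝ => invStereo L p (s • EuclideanSpace.single i 1))
      (lineVelocity (L (EuclideanSpace.single i 1)) p t) t := by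
  have h0 : (t ^ 2 + 4) ≠ 0 := by positivity
  have hd : HasDerivAt (fun s : ℝ => s ^ 2 + 4) (2 * t) t := by
    simpa using (hasDerivAt_pow 2 t).add_const 4
  have h1 : HasDerivAt (fun s : ℝ => 4 * s / (s ^ 2 + 4))
      ((16 - 4 * t ^ 2) / (t ^ 2 + 4) ^ 2) t := by
    have := ((hasDerivAt_id t).const_mul 4).div hd h0
    convert! this using 1
    simp only [id]; field_simp; ring
  have h2 : HasDerivAt (fun s : ℝ => (4 - s ^ 2) / (s ^ 2 + 4))
      (-16 * t / (t ^ 2 + 4) ^ 2) t := by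
    have h3 : HasDerivAt (fun s : ℝ => 4 - s ^ 2) (-(2 * t)) t := by
      simpa using (hasDerivAt_pow 2 t).const_sub 4
    convert! h3.div hd h0 using 1
    field_simp; ring
  have h := (h1.smul_const (L (EuclideanSpace.single i 1))).add (h2.smul_const p)
  refine h.congr_of_eventuallyEq (Eventually.of_forall fun s => ?_)
  exact invStereo_smul_single L p i s

lemma hasDerivAt_lineVelocity_zero (b p : Ambient n) :
    HasDerivAt (lineVelocity b p) (-p) 0 := by
  have h0 : ((0 : ℝ) ^ 2 + 4) ^ 2 ≠ 0 := by positivity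
  have hd : HasDerivAt (fun s : ℝ => (s ^ 2 + 4) ^ 2) 0 0 := by
    have := ((hasDerivAt_pow 2 (0 : ℝ)).add_const 4).pow 2
    convert! this using 1
    simp
  have h1 : HasDerivAt (fun s : ℝ => (16 - 4 * s ^ 2) / (s ^ 2 + 4) ^ 2) 0 0 := by
    have h3 : HasDerivAt (fun s : ℝ => 16 - 4 * s ^ 2) 0 0 := by
      simpa using ((hasDerivAt_pow 2 (0 : ℝ)).const_mul 4).const_sub 16
    convert! h3.div hd h0 using 1
    simp
  have h2 : HasDerivAt (fun s : ℝ => -16 * s / (s ^ 2 + 4) ^ 2) (-1) 0 := by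
    have := ((hasDerivAt_id (0 : ℝ)).const_mul (-16)).div hd h0
    convert! this using 1
    norm_num
  have h := (h1.smul_const b).add (h2.smul_const p)
  have e : (0 : ℝ) • b + (-1 : ℝ) • p = -p := by simp
  rw [e] at h
  exact h

lemma lineVelocity_zero (b p : Ambient n) : lineVelocity b p 0 = b := by
  simp [lineVelocity]; norm_num

lemma invStereo_zero (L : EuclideanSpace ℝ (Fin n) →ₗᵢ[ℝ] Ambient n) (p : Ambient n) :
    invStereo L p 0 = p := by
  simp [invStereo, smul_smul]

lemma pd_eq_of_hasDerivAt_line {F : Type*} [NormedAddCommGroup F] [NormedSpace ℝ F]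
    {u : EuclideanSpace ℝ (Fin n) → F} {i : Fin n} {t : ℝ} {u' : F}
    (hu : DifferentiableAt ℝ u (t • EuclideanSpace.single i 1))
    (h : HasDerivAt (fun s : ℝ => u (s • EuclideanSpace.single i 1)) u' t) :
    pd i u (t • EuclideanSpace.single i 1) = u' := by
  have h1 : HasDerivAt (fun s : ℝ => s • EuclideanSpace.single i (1 : ℝ))
      (EuclideanSpace.single i (1 : ℝ)) t := by
    simpa using (hasDerivAt_id t).smul_const (EuclideanSpace.single i (1 : ℝ))
  exact (hu.hasFDerivAt.comp_hasDerivAt t h1).unique h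

lemma metric_invStereo_zero (L : EuclideanSpace ℝ (Fin n) →ₗᵢ[ℝ] Ambient n) (p : Ambient n) :
    metric (invStereo L p) 0 = 1 := by
  have h : ∀ i : Fin n, pd i (invStereo L p) 0 = L (EuclideanSpace.single i 1) := fun i => by
    have := pd_eq_of_hasDerivAt_line (i := i) (t := 0)
      ((contDiff_invStereo L p (k := 1)).differentiable one_ne_zero _)
      (hasDerivAt_invStereo_line L p i 0)
    rwa [zero_smul, lineVelocity_zero] at this
  ext i j
  simp only [metric, Matrix.of_apply, h, L.inner_map_map, Matrix.one_apply]
  simp [EuclideanSpace.inner_single_left, PiLp.single_apply]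

lemma coordLaplacian_invStereo_zero {L : EuclideanSpace ℝ (Fin n) →ₗᵢ[ℝ] Ambient n}
    {p : Ambient n} (hL : ∀ y, inner ℝ p (L y) = 0) (u : EuclideanSpace ℝ (Fin n) → ℂ) :
    coordLaplacian (invStereo L p) u 0 = ∑ i, pd i (pd i u) 0 := by
  have hΓ : ∀ k i j, christoffel (invStereo L p) k i j 0 = 0 := by
    intro k i j
    have h : ∀ a b c : Fin n, pd a (fun z => metric (invStereo L p) z b c) 0 = 0 :=
      fun a b c => pd_zero_of_even (fun y => metric_invStereo_neg hL y b c) a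
    simp [christoffel, h]
  simp only [coordLaplacian, metric_invStereo_zero, inv_one, hessian, hΓ, zero_smul,
    Finset.sum_const_zero, sub_zero, Matrix.one_apply, ite_smul, one_smul,
    Finset.sum_ite_eq, Finset.mem_univ, if_true]

/-- Second derivative of an ambient function along a coordinate line of stereographic
coordinates: the line has acceleration `-p` at `p`. -/
lemma pd_pd_comp_invStereo (L : EuclideanSpace ℝ (Fin n) →ₗᵢ[ℝ] Ambient n) {p : Ambient n}
    {F : Ambient n → ℂ} (hF : ContDiffAt ℝ 2 F p) (i : Fin n) :
    pd i (pd i (fun y => F (invStereo L p y))) 0 =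
      fderiv ℝ (fderiv ℝ F) p (L (EuclideanSpace.single i 1)) (L (EuclideanSpace.single i 1))
        - fderiv ℝ F p p := by
  set e := EuclideanSpace.single i (1 : ℝ) with he
  set c : ℝ → Ambient n := fun s => invStereo L p (s • e) with hc
  have hc0 : c 0 = p := by simp [hc, invStereo_zero]
  have hFψ : ContDiffAt ℝ 2 (fun y => F (invStereo L p y)) 0 := by
    have h1 := (contDiff_invStereo L p (k := 2)).contDiffAt (x := 0)
    rw [← invStereo_zero L p] at hF
    exact hF.comp 0 h1
  have hcc : ContinuousAt c 0 := (hasDerivAt_invStereo_line L p i 0).continuousAt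
  -- the first derivative along the line, near the origin
  have hline : ∀ᶠ t : ℝ in 𝓝 0, pd i (fun y => F (invStereo L p y)) (t • e)
      = fderiv ℝ F (c t) (lineVelocity (L e) p t) := by
    have h1 : ∀ᶠ x in 𝓝 p, ContDiffAt ℝ 2 F x := hF.eventually (by simp)
    rw [← hc0] at h1
    filter_upwards [hcc.eventually h1] with t ht
    have hdF : DifferentiableAt ℝ F (c t) := ht.differentiableAt (by norm_num)
    refine pd_eq_of_hasDerivAt_line ?_ ?_
    · exact DifferentiableAt.comp (t • e) hdF
        ((contDiff_invStereo L p (k := 1)).differentiable one_ne_zero _)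
    · exact hdF.hasFDerivAt.comp_hasDerivAt t (hasDerivAt_invStereo_line L p i t)
  have hd2 : HasDerivAt (fun t : ℝ => fderiv ℝ F (c t) (lineVelocity (L e) p t))
      (fderiv ℝ (fderiv ℝ F) p (L e) (L e) - fderiv ℝ F p p) 0 := by
    have h1 : DifferentiableAt ℝ (fderiv ℝ F) p :=
      (hF.fderiv_right (m := 1) (by norm_num)).differentiableAt one_ne_zero
    have h2 : HasDerivAt c (L e) 0 := by
      have := hasDerivAt_invStereo_line L p i 0
      rwa [lineVelocity_zero] at this
    have h3 : HasDerivAt (fun t => fderiv ℝ F (c t)) (fderiv ℝ (fderiv ℝ F) p (L e)) 0 := by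
      rw [← hc0] at h1 ⊢
      exact h1.hasFDerivAt.comp_hasDerivAt 0 h2
    have h4 := h3.clm_apply (hasDerivAt_lineVelocity_zero (L e) p)
    rw [hc0, lineVelocity_zero] at h4
    simpa [sub_eq_add_neg] using h4
  have h5 : DifferentiableAt ℝ (pd i (fun y => F (invStereo L p y))) ((0 : ℝ) • e) := by
    have h : ContDiffAt ℝ 1 (fderiv ℝ (fun y => F (invStereo L p y))) 0 :=
      hFψ.fderiv_right (m := 1) (by norm_num)
    rw [zero_smul]
    exact (h.differentiableAt (by norm_num)).clm_apply (differentiableAt_const _)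
  have h6 := pd_eq_of_hasDerivAt_line h5 (hd2.congr_of_eventuallyEq hline)
  rwa [zero_smul] at h6

lemma laplacian_eq_sum_fderiv {F : Type*} [NormedAddCommGroup F] [NormedSpace ℝ F]
    {ι : Type*} [Fintype ι] (f : Ambient n → F) (v : OrthonormalBasis ι ℝ (Ambient n))
    (x : Ambient n) :
    Laplacian.laplacian f x = ∑ i, fderiv ℝ (fderiv ℝ f) x (v i) (v i) := by
  rw [laplacian_eq_iteratedFDeriv_orthonormalBasis f v]
  simp [iteratedFDeriv_two_apply]

/-- The trace of the ambient Hessian over the tangent space of the sphere at `p`. -/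
lemma sum_hessian_tangent {L : EuclideanSpace ℝ (Fin n) →ₗᵢ[ℝ] Ambient n}
    {p : Ambient n} (hp : ‖p‖ = 1) (hL : ∀ y, inner ℝ p (L y) = 0) (F : Ambient n → ℂ) :
    ∑ i, fderiv ℝ (fderiv ℝ F) p (L (EuclideanSpace.single i 1))
        (L (EuclideanSpace.single i 1))
      = Laplacian.laplacian F p - fderiv ℝ (fderiv ℝ F) p p p := by
  let v : Option (Fin n) → Ambient n := fun o => o.elim p fun i => L (EuclideanSpace.single i 1)
  have hv : Orthonormal ℝ v := by
    constructor
    · rintro (_ | i)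
      · simpa [v] using hp
      · simp [v]
    · rintro (_ | i) (_ | j) hij
      · exact absurd rfl hij
      · exact hL _
      · exact (real_inner_comm _ _).trans (hL _)
      · have : i ≠ j := fun h => hij (by rw [h])
        simp [v, L.inner_map_map, EuclideanSpace.inner_single_left, this]
  have hcard : Fintype.card (Option (Fin n)) = finrank ℝ (Ambient n) := by simp
  let b : OrthonormalBasis (Option (Fin n)) ℝ (Ambient n) :=
    OrthonormalBasis.mk hv (by
      rw [← coe_basisOfOrthonormalOfCardEqFinrank hv hcard]
      exact (basisOfOrthonormalOfCardEqFinrank hv hcard).span_eq.ge)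
  rw [laplacian_eq_sum_fderiv F b p, Fintype.sum_option]
  simp [b, v]

/-- The Laplace-Beltrami operator applied to the restriction of an ambient function. -/
lemma laplacian_restrict {f : Sph n → ℂ} {F : Ambient n → ℂ} (p : Sph n)
    (hF : ContDiffAt ℝ 2 F p) (hf : ∀ q : Sph n, F q = f q) :
    laplacian f p = Laplacian.laplacian F (p : Ambient n)
      - fderiv ℝ (fderiv ℝ F) (p : Ambient n) (p : Ambient n) (p : Ambient n)
      - n * fderiv ℝ F (p : Ambient n) (p : Ambient n) := by
  obtain ⟨L, hL, hψ⟩ := exists_chartAt_symm_eq_invStereo p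
  have h1 : (fun y => (((chartAt (EuclideanSpace ℝ (Fin n)) p).symm y : Sph n) : Ambient n))
    = invStereo L p := funext hψ
  have h2 : (fun y => f ((chartAt (EuclideanSpace ℝ (Fin n)) p).symm y))
    = fun y => F (invStereo L p y) := by
    funext y; rw [← hψ, hf]
  rw [laplacian, h1, h2, chartAt_self_eq_zero, coordLaplacian_invStereo_zero hL]
  simp_rw [pd_pd_comp_invStereo L hF]
  rw [Finset.sum_sub_distrib, sum_hessian_tangent (by simp) hL]
  simp

/-- For a function homogeneous of degree `ℓ` along the ray through `p`, the radial derivatives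
are determined by its value at `p`. -/
lemma laplacian_restrict_of_homogeneous {f : Sph n → ℂ} {F : Ambient n → ℂ} (p : Sph n) (ℓ : ℕ)
    (hF : ContDiffAt ℝ 2 F p) (hf : ∀ q : Sph n, F q = f q)
    (hhom : ∀ᶠ t : ℝ in 𝓝 1, F (t • (p : Ambient n)) = (t : ℂ) ^ ℓ * F p) :
    laplacian f p = Laplacian.laplacian F (p : Ambient n) - ((ℓ : ℝ) * (ℓ + n - 1) : ℝ) * f p := by
  set x : Ambient n := (p : Ambient n) with hx
  have hray : ∀ t : ℝ, HasDerivAt (fun s : ℝ => s • x) x t := fun t => by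
    simpa using (hasDerivAt_id t).smul_const x
  have hpow : ∀ (k : ℕ) (t : ℝ), HasDerivAt (fun s : ℝ => (s : ℂ) ^ k)
      (k * (t : ℂ) ^ (k - 1)) t := fun k t => by
    simpa using (hasDerivAt_pow k (t : ℂ)).comp_ofReal
  have h1 : ∀ᶠ t : ℝ in 𝓝 1, fderiv ℝ F (t • x) x = ℓ * (t : ℂ) ^ (ℓ - 1) * F x := by
    have h2 : ∀ᶠ y in 𝓝 x, ContDiffAt ℝ 2 F y := hF.eventually (by simp)
    have h3 : ContinuousAt (fun s : ℝ => s • x) 1 := (hray 1).continuousAt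
    rw [← one_smul ℝ x] at h2
    filter_upwards [h3.eventually h2, eventually_eventually_nhds.mpr hhom] with t ht ht2
    have h4 := (ht.differentiableAt (by norm_num)).hasFDerivAt.comp_hasDerivAt t (hray t)
    exact h4.unique (((hpow ℓ t).mul_const (F x)).congr_of_eventuallyEq ht2)
  have hD : fderiv ℝ F x x = ℓ * F x := by
    have := h1.self_of_nhds
    simpa using this
  have hD2 : fderiv ℝ (fderiv ℝ F) x x x = ℓ * (ℓ - 1) * F x := by
    have h2 : DifferentiableAt ℝ (fderiv ℝ F) ((1 : ℝ) • x) := by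
      rw [one_smul]
      exact (hF.fderiv_right (m := 1) (by norm_num)).differentiableAt one_ne_zero
    have h3 : HasDerivAt (fun t : ℝ => fderiv ℝ F (t • x))
        (fderiv ℝ (fderiv ℝ F) ((1 : ℝ) • x) x) 1 :=
      h2.hasFDerivAt.comp_hasDerivAt (1 : ℝ) (hray 1)
    have h3' : HasDerivAt (fun t : ℝ => fderiv ℝ F (t • x) x)
        (fderiv ℝ (fderiv ℝ F) ((1 : ℝ) • x) x x) 1 := by
      simpa using h3.clm_apply (hasDerivAt_const (1 : ℝ) x)
    have h4 : HasDerivAt (fun t : ℝ => fderiv ℝ F (t • x) x)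
        (ℓ * ((ℓ - 1 : ℕ) * ((1 : ℝ) : ℂ) ^ (ℓ - 1 - 1)) * F x) 1 :=
      (((hpow (ℓ - 1) 1).const_mul (ℓ : ℂ)).mul_const (F x)).congr_of_eventuallyEq h1
    have h5 := h3'.unique h4
    rw [one_smul] at h5
    rw [h5, Complex.ofReal_one, one_pow, mul_one]
    rcases ℓ with _ | m
    · simp
    · simp
  rw [laplacian_restrict p hF hf, ← hx, hD, hD2, ← hf p, ← hx]
  push_cast
  ring

end Chart

/-! ### Symmetric tensors and homogeneous polynomials -/

section Tensors

variable {n ℓ m : ℕ}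

/-- Multi-indices with the same values, counted with multiplicity, differ by a permutation: match
their fibres. -/
lemma exists_perm_comp_eq {α ι : Type*} [Fintype ι] [DecidableEq α] {I J : ι → α}
    (h : Finset.univ.val.map I = Finset.univ.val.map J) :
    ∃ σ : Equiv.Perm ι, I ∘ σ = J := by
  have hcard : ∀ c, Fintype.card {k // J k = c} = Fintype.card {k // I k = c} := fun c => by
    have h1 : ∀ K : ι → α, Fintype.card {k // K k = c} = (Finset.univ.val.map K).count c :=
      fun K => by
        rw [Fintype.card_subtype, Multiset.count_map]
        simp only [eq_comm (a := c)]
        rfl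
    rw [h1, h1, h]
  let e : ∀ c, {k // J k = c} ≃ {k // I k = c} := fun c => Fintype.equivOfCardEq (hcard c)
  exact ⟨Equiv.ofFiberEquiv e, funext fun k => Equiv.ofFiberEquiv_map e k⟩

lemma IsSymm.eq_of_map_eq {a : Tensor n ℓ} (ha : IsSymm a) {I J : Fin ℓ → Fin (n + 1)}
    (h : Finset.univ.val.map I = Finset.univ.val.map J) : a I = a J := by
  obtain ⟨σ, rfl⟩ := exists_perm_comp_eq h
  exact (ha σ I).symm

lemma IsSymm.eq_of_ofFn_perm {a : Tensor n ℓ} (ha : IsSymm a) {I J : Fin ℓ → Fin (n + 1)}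
    (h : (List.ofFn I).Perm (List.ofFn J)) : a I = a J := by
  refine ha.eq_of_map_eq ?_
  rw [Fin.univ_val_map, Fin.univ_val_map]
  exact Multiset.coe_eq_coe.mpr h

/-- The tensor `a_{A ···}` with the first index fixed. -/
def slice (a : Tensor n (ℓ + 1)) (A : Fin (n + 1)) : Tensor n ℓ := fun J => a (Fin.cons A J)

lemma IsSymm.slice {a : Tensor n (ℓ + 1)} (ha : IsSymm a) (A : Fin (n + 1)) :
    IsSymm (slice a A) := fun σ J => by
  refine ha.eq_of_ofFn_perm ?_
  simp only [List.ofFn_cons]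
  exact (Equiv.Perm.ofFn_comp_perm σ J).cons A

lemma IsSymm.slice_comm {a : Tensor n (ℓ + 2)} (ha : IsSymm a) (A B : Fin (n + 1)) :
    SphereHarmonics.slice (SphereHarmonics.slice a A) B
      = SphereHarmonics.slice (SphereHarmonics.slice a B) A := by
  funext J
  refine ha.eq_of_ofFn_perm ?_
  simp only [List.ofFn_cons]
  exact List.Perm.swap _ _ _

/-- The contraction of the last two indices. -/
def trace (a : Tensor n (m + 2)) : Tensor n m :=
  fun J => ∑ B : Fin (n + 1), a (Fin.append J ![B, B])

lemma isTraceless_iff {a : Tensor n (m + 2)} : IsTraceless a ↔ trace a = 0 :=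
  funext_iff.symm

lemma IsSymm.apply_append {a : Tensor n (m + 2)} (ha : IsSymm a) (J : Fin m → Fin (n + 1))
    (A B : Fin (n + 1)) :
    a (Fin.append J ![A, B]) = SphereHarmonics.slice (SphereHarmonics.slice a A) B J := by
  refine ha.eq_of_ofFn_perm ?_
  simp only [List.ofFn_cons, List.ofFn_fin_append]
  refine List.perm_append_comm.trans ?_
  simp

lemma IsSymm.trace_eq {a : Tensor n (m + 2)} (ha : IsSymm a) :
    trace a = ∑ B, SphereHarmonics.slice (SphereHarmonics.slice a B) B := by
  funext J
  simp only [trace, ha.apply_append, Finset.sum_apply]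

lemma IsSymm.trace {a : Tensor n (m + 2)} (ha : IsSymm a) : IsSymm (trace a) := fun σ J => by
  refine Finset.sum_congr rfl fun B _ => ?_
  rw [ha.apply_append, ha.apply_append]
  exact ((ha.slice B).slice B) σ J

lemma trace_slice {a : Tensor n (m + 3)} (ha : IsSymm a) (A : Fin (n + 1)) :
    trace (slice a A) = slice (trace a) A := by
  funext J
  rw [(ha.slice A).trace_eq]
  simp only [slice, ha.trace_eq, Finset.sum_apply]
  refine Finset.sum_congr rfl fun B _ => ha.eq_of_ofFn_perm ?_
  simp only [List.ofFn_cons]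
  exact (List.Perm.swap _ _ _).trans ((List.Perm.swap _ _ _).cons _)

lemma IsTraceless.slice {a : Tensor n (ℓ + 1)} (ha : IsSymm a) (ht : IsTraceless a)
    (A : Fin (n + 1)) : IsTraceless (SphereHarmonics.slice a A) := by
  match ℓ, a, ha, ht with
  | 0, _, _, _ => trivial
  | 1, _, _, _ => trivial
  | m + 2, a, ha, ht =>
    rw [isTraceless_iff] at ht ⊢
    rw [trace_slice ha, ht]
    rfl

/-- The homogeneous polynomial `a_{A₁…A_ℓ} x^{A₁} ⋯ x^{A_ℓ}` on the ambient space. -/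
def homPoly (a : Tensor n ℓ) (x : Ambient n) : ℂ :=
  ∑ I : Fin ℓ → Fin (n + 1), a I * ∏ k, ((x (I k) : ℝ) : ℂ)

lemma homPoly_coe (a : Tensor n ℓ) (Ω : Sph n) : homPoly a (Ω : Ambient n) = Y a Ω := rfl

lemma contDiff_homPoly (a : Tensor n ℓ) {k : ℕ∞ω} : ContDiff ℝ k (homPoly a) := by
  unfold homPoly
  refine ContDiff.sum fun I _ => contDiff_const.mul ?_
  refine contDiff_prod fun j _ => ?_
  have h : ContDiff ℝ k fun x : Ambient n => x (I j) :=
    (EuclideanSpace.proj (𝕜 := ℝ) (I j) : Ambient n →L[ℝ] ℝ).contDiff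
  exact Complex.ofRealCLM.contDiff.comp h

lemma continuous_homPoly (a : Tensor n ℓ) : Continuous (homPoly a) :=
  (contDiff_homPoly (k := 0) a).continuous

lemma differentiable_homPoly (a : Tensor n ℓ) : Differentiable ℝ (homPoly a) :=
  (contDiff_homPoly (k := 1) a).differentiable one_ne_zero

lemma homPoly_smul_arg (a : Tensor n ℓ) (t : ℝ) (x : Ambient n) :
    homPoly a (t • x) = (t : ℂ) ^ ℓ * homPoly a x := by
  simp only [homPoly, PiLp.smul_apply, smul_eq_mul, Complex.ofReal_mul, Finset.prod_mul_distrib,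
    Finset.prod_const, Finset.card_univ, Fintype.card_fin, Finset.mul_sum]
  exact Finset.sum_congr rfl fun I _ => by ring

lemma homPoly_add (a b : Tensor n ℓ) : homPoly (a + b) = homPoly a + homPoly b := by
  funext x
  simp [homPoly, add_mul, Finset.sum_add_distrib]

lemma homPoly_const_smul (c : ℂ) (a : Tensor n ℓ) : homPoly (c • a) = c • homPoly a := by
  funext x
  simp [homPoly, Finset.mul_sum, mul_assoc]

/-- The linear map `a ↦ homPoly a`. -/
def homPolyₗ : Tensor n ℓ →ₗ[ℂ] (Ambient n → ℂ) where
  toFun := homPoly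
  map_add' := homPoly_add
  map_smul' := homPoly_const_smul

lemma homPoly_zero_tensor : homPoly (0 : Tensor n ℓ) = 0 := (homPolyₗ (n := n) (ℓ := ℓ)).map_zero

lemma homPoly_sum {ι : Type*} (s : Finset ι) (a : ι → Tensor n ℓ) (x : Ambient n) :
    homPoly (∑ i ∈ s, a i) x = ∑ i ∈ s, homPoly (a i) x := by
  have := map_sum (homPolyₗ (n := n) (ℓ := ℓ)) a s
  have h := congrFun this x
  rwa [Finset.sum_apply] at h

lemma homPoly_rank_zero (a : Tensor n 0) (x : Ambient n) : homPoly a x = a ![] := by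
  simp [homPoly, Subsingleton.elim default ![]]

lemma sum_cons {M : Type*} [AddCommMonoid M] (f : (Fin (ℓ + 1) → Fin (n + 1)) → M) :
    ∑ I, f I = ∑ A, ∑ J : Fin ℓ → Fin (n + 1), f (Fin.cons A J) := by
  rw [← (Fin.consEquiv fun _ => Fin (n + 1)).sum_comp, Fintype.sum_prod_type]
  rfl

lemma homPoly_eq_sum_slice (a : Tensor n (ℓ + 1)) (x : Ambient n) :
    homPoly a x = ∑ A, ((x A : ℝ) : ℂ) * homPoly (slice a A) x := by
  simp only [homPoly, sum_cons, Fin.prod_univ_succ, Fin.cons_zero, Fin.cons_succ, slice,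
    Finset.mul_sum]
  exact Finset.sum_congr rfl fun A _ => Finset.sum_congr rfl fun J _ => by ring

lemma hasFDerivAt_coord (A : Fin (n + 1)) (x : Ambient n) :
    HasFDerivAt (fun y : Ambient n => ((y A : ℝ) : ℂ))
      (Complex.ofRealCLM.comp (EuclideanSpace.proj (𝕜 := ℝ) A : Ambient n →L[ℝ] ℝ)) x :=
  (Complex.ofRealCLM.comp (EuclideanSpace.proj (𝕜 := ℝ) A : Ambient n →L[ℝ] ℝ)).hasFDerivAt

/-- Leibniz rule for `a_{A ···} x^A ⋯`, without symmetry of `a`. -/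
lemma fderiv_homPoly_aux (a : Tensor n (ℓ + 1)) (x v : Ambient n) :
    fderiv ℝ (homPoly a) x v = ∑ A, (((v A : ℝ) : ℂ) * homPoly (slice a A) x
      + ((x A : ℝ) : ℂ) * fderiv ℝ (homPoly (slice a A)) x v) := by
  have h : HasFDerivAt (fun y => ∑ A, ((y A : ℝ) : ℂ) * homPoly (slice a A) y) _ x :=
    HasFDerivAt.fun_sum fun A _ =>
      (hasFDerivAt_coord A x).mul (differentiable_homPoly (slice a A) x).hasFDerivAt
  have h2 : homPoly a = fun y => ∑ A, ((y A : ℝ) : ℂ) * homPoly (slice a A) y :=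
    funext (homPoly_eq_sum_slice a)
  rw [h2, h.fderiv]
  simp only [sum_apply, add_apply,
    smul_apply, ContinuousLinearMap.comp_apply, smul_eq_mul]
  refine Finset.sum_congr rfl fun A _ => ?_
  change _ * _ + _ * ((v A : ℝ) : ℂ) = _
  ring

lemma fderiv_homPoly_rank_zero (a : Tensor n 0) (x : Ambient n) :
    fderiv ℝ (homPoly a) x = 0 := by
  rw [funext (homPoly_rank_zero a)]
  simp

lemma fderiv_homPoly {a : Tensor n (ℓ + 1)} (ha : IsSymm a) (x v : Ambient n) :
    fderiv ℝ (homPoly a) x v = (ℓ + 1) * ∑ A, ((v A : ℝ) : ℂ) * homPoly (slice a A) x := by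
  induction ℓ with
  | zero =>
    rw [fderiv_homPoly_aux]
    simp [fderiv_homPoly_rank_zero]
  | succ ℓ ih =>
    rw [fderiv_homPoly_aux, Finset.sum_add_distrib]
    have h : ∑ A, ((x A : ℝ) : ℂ) * fderiv ℝ (homPoly (slice a A)) x v
        = (ℓ + 1) * ∑ B, ((v B : ℝ) : ℂ) * homPoly (slice a B) x := by
      simp_rw [ih (ha.slice _), homPoly_eq_sum_slice (slice a _), Finset.mul_sum]
      rw [Finset.sum_comm]
      refine Finset.sum_congr rfl fun B _ => Finset.sum_congr rfl fun A _ => ?_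
      rw [ha.slice_comm A B]
      ring
    rw [h]
    push_cast
    ring

/-- The partial derivative of a homogeneous polynomial with symmetric coefficients. -/
lemma fderiv_homPoly_single {a : Tensor n (ℓ + 1)} (ha : IsSymm a) (x : Ambient n)
    (A : Fin (n + 1)) :
    fderiv ℝ (homPoly a) x (EuclideanSpace.single A 1) = (ℓ + 1) * homPoly (slice a A) x := by
  rw [fderiv_homPoly ha]
  congr 1
  rw [Finset.sum_eq_single A]
  · simp
  · intro B _ hB
    simp [hB]
  · simp

lemma fderiv_fderiv_homPoly {a : Tensor n (m + 2)} (ha : IsSymm a) (x : Ambient n)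
    (A B : Fin (n + 1)) :
    fderiv ℝ (fderiv ℝ (homPoly a)) x (EuclideanSpace.single A 1) (EuclideanSpace.single B 1)
      = (m + 2) * (m + 1) * homPoly (slice (slice a B) A) x := by
  have h1 : Differentiable ℝ (fderiv ℝ (homPoly a)) :=
    ((contDiff_homPoly a (k := 2)).fderiv_right (m := 1) (by norm_num)).differentiable one_ne_zero
  have h2 : (fun y => fderiv ℝ (homPoly a) y (EuclideanSpace.single B 1))
      = fun y => (m + 2 : ℂ) * homPoly (slice a B) y := by
    funext y
    rw [fderiv_homPoly_single ha]
    push_cast; ring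
  have h3 := ((h1 x).hasFDerivAt.clm_apply
    (hasFDerivAt_const (EuclideanSpace.single B (1 : ℝ)) x)).fderiv
  rw [h2, fderiv_const_mul (differentiable_homPoly _ x)] at h3
  have h4 := congrArg (fun T => T (EuclideanSpace.single A 1)) h3
  simp only [smul_apply, fderiv_homPoly_single (ha.slice B)] at h4
  simp at h4
  rw [← h4]
  ring

lemma laplacian_homPoly {a : Tensor n (m + 2)} (ha : IsSymm a) (x : Ambient n) :
    Laplacian.laplacian (homPoly a) x = (m + 2) * (m + 1) * homPoly (trace a) x := by
  rw [laplacian_eq_sum_fderiv _ (EuclideanSpace.basisFun _ ℝ)]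
  simp only [EuclideanSpace.basisFun_apply, fderiv_fderiv_homPoly ha, ha.trace_eq, homPoly_sum,
    Finset.mul_sum]

/-- Polynomials of degree at most one have constant derivative. -/
lemma laplacian_homPoly_of_le_one {a : Tensor n ℓ} (hℓ : ℓ ≤ 1) (x : Ambient n) :
    Laplacian.laplacian (homPoly a) x = 0 := by
  have h : ∃ c, fderiv ℝ (homPoly a) = fun _ => c := by
    interval_cases ℓ
    · exact ⟨0, funext (fderiv_homPoly_rank_zero a)⟩
    · refine ⟨fderiv ℝ (homPoly a) 0, funext fun y => ContinuousLinearMap.ext fun v => ?_⟩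
      have ha : IsSymm a := fun σ I => by rw [Subsingleton.elim σ 1]; rfl
      rw [fderiv_homPoly ha, fderiv_homPoly ha]
      simp only [homPoly_rank_zero]
  obtain ⟨c, hc⟩ := h
  rw [laplacian_eq_sum_fderiv _ (EuclideanSpace.basisFun _ ℝ), hc]
  simp

lemma homPoly_eq_zero_of_sphere {a : Tensor n ℓ} (h : ∀ Ω : Sph n, Y a Ω = 0) :
    homPoly a = 0 := by
  funext x
  obtain ⟨u, hu⟩ : ∃ u : Sph n, x = ‖x‖ • (u : Ambient n) := by
    rcases eq_or_ne x 0 with rfl | hx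
    · exact ⟨⟨EuclideanSpace.single 0 1, by simp⟩, by simp⟩
    · have h0 : ‖x‖ ≠ 0 := norm_ne_zero_iff.mpr hx
      exact ⟨⟨‖x‖⁻¹ • x, by simp [norm_smul, h0]⟩, by simp [smul_smul, h0]⟩
  rw [hu, homPoly_smul_arg, homPoly_coe, h, mul_zero]
  rfl

/-- A symmetric tensor is recovered from its polynomial by repeated differentiation. -/
lemma eq_zero_of_homPoly_eq_zero {a : Tensor n ℓ} (ha : IsSymm a) (h : homPoly a = 0) :
    a = 0 := by
  induction ℓ with
  | zero =>
    funext I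
    have := homPoly_rank_zero a 0
    rw [h] at this
    rw [Subsingleton.elim I ![], ← this]
    rfl
  | succ ℓ ih =>
    funext I
    have h1 : slice a (I 0) = 0 := by
      refine ih (ha.slice _) (funext fun x => ?_)
      have := fderiv_homPoly_single ha x (I 0)
      rw [h] at this
      have h2 : ((ℓ : ℂ) + 1) ≠ 0 := by exact_mod_cast ℓ.succ_ne_zero
      simpa [h2] using this.symm
    have h2 := congrFun h1 (Fin.tail I)
    rwa [slice, Fin.cons_self_tail] at h2

/-- A symmetric tensor is determined by the values of its polynomial on the sphere. -/
lemma eq_zero_of_Y_eq_zero {a : Tensor n ℓ} (ha : IsSymm a) (h : ∀ Ω : Sph n, Y a Ω = 0) :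
    a = 0 :=
  eq_zero_of_homPoly_eq_zero ha (homPoly_eq_zero_of_sphere h)

/-! ### Symmetrization -/

lemma isSymm_symmPart (a : Tensor n ℓ) : IsSymm (symmPart a) := fun τ I => by
  simp only [symmPart]
  congr 1
  exact Fintype.sum_equiv (Equiv.mulLeft τ) _ _ fun σ => rfl

lemma sum_comp_perm {M : Type*} [AddCommMonoid M] (σ : Equiv.Perm (Fin ℓ))
    (f : (Fin ℓ → Fin (n + 1)) → M) : ∑ I, f (I ∘ σ) = ∑ I, f I :=
  (Equiv.arrowCongr σ.symm (Equiv.refl (Fin (n + 1)))).sum_comp f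

/-- Against symmetric weights a tensor may be replaced by its symmetric part. -/
lemma sum_symmPart_mul (a : Tensor n ℓ) {w : Tensor n ℓ} (hw : IsSymm w) :
    ∑ I, symmPart a I * w I = ∑ I, a I * w I := by
  have h : ∀ σ : Equiv.Perm (Fin ℓ), ∑ I, a (I ∘ σ) * w I = ∑ I, a I * w I := fun σ => by
    rw [← sum_comp_perm σ fun I => a I * w I]
    exact Finset.sum_congr rfl fun I _ => by rw [hw σ I]
  simp only [symmPart, mul_assoc, Finset.sum_mul, ← Finset.mul_sum]
  rw [Finset.sum_comm]
  simp only [h, Finset.sum_const, Finset.card_univ, Fintype.card_perm, Fintype.card_fin,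
    nsmul_eq_mul]
  rw [← mul_assoc, inv_mul_cancel₀ (by exact_mod_cast ℓ.factorial_ne_zero), one_mul]

lemma homPoly_symmPart (a : Tensor n ℓ) : homPoly (symmPart a) = homPoly a := by
  funext x
  refine sum_symmPart_mul a (w := fun I => ∏ k, ((x (I k) : ℝ) : ℂ)) fun σ I => ?_
  exact Equiv.prod_comp σ fun k => ((x (I k) : ℝ) : ℂ)

lemma Y_symmPart (a : Tensor n ℓ) : Y (symmPart a) = Y a :=
  funext fun Ω => congrFun (homPoly_symmPart a) (Ω : Ambient n)

/-- The space of symmetric tensors of rank `ℓ`. -/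
def symTensors (n ℓ : ℕ) : Submodule ℂ (Tensor n ℓ) where
  carrier := {a | IsSymm a}
  add_mem' := fun ha hb σ I => by simp only [Pi.add_apply, ha σ I, hb σ I]
  zero_mem' := fun _ _ => rfl
  smul_mem' := fun c a ha σ I => by simp only [Pi.smul_apply, ha σ I]

/-- The contraction as a linear map on all tensors of rank at least two. -/
def traceₗ : Tensor n (m + 2) →ₗ[ℂ] Tensor n m where
  toFun := trace
  map_add' a b := by funext J; simp [trace, Finset.sum_add_distrib]
  map_smul' c a := by funext J; simp [trace, Finset.mul_sum]

lemma IsTraceless.add {a b : Tensor n ℓ} (ha : IsTraceless a) (hb : IsTraceless b) :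
    IsTraceless (a + b) := by
  match ℓ, a, b, ha, hb with
  | 0, _, _, _, _ => trivial
  | 1, _, _, _, _ => trivial
  | m + 2, a, b, ha, hb =>
    rw [isTraceless_iff] at *
    exact (traceₗ.map_add a b).trans (by rw [show traceₗ a = 0 from ha,
      show traceₗ b = 0 from hb, add_zero])

lemma isTraceless_zero : IsTraceless (0 : Tensor n ℓ) := by
  match ℓ with
  | 0 => trivial
  | 1 => trivial
  | m + 2 => exact isTraceless_iff.mpr traceₗ.map_zero

lemma IsTraceless.smul {a : Tensor n ℓ} (c : ℂ) (ha : IsTraceless a) :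
    IsTraceless (c • a) := by
  match ℓ, a, ha with
  | 0, _, _ => trivial
  | 1, _, _ => trivial
  | m + 2, a, ha =>
    rw [isTraceless_iff] at *
    exact (traceₗ.map_smul c a).trans (by rw [show traceₗ a = 0 from ha, smul_zero])

/-- The space of symmetric traceless tensors of rank `ℓ`. -/
def harmonicTensors (n ℓ : ℕ) : Submodule ℂ (Tensor n ℓ) where
  carrier := {a | IsSymm a ∧ IsTraceless a}
  add_mem' := fun ha hb => ⟨(symTensors n ℓ).add_mem ha.1 hb.1, ha.2.add hb.2⟩
  zero_mem' := ⟨(symTensors n ℓ).zero_mem, isTraceless_zero⟩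
  smul_mem' := fun c _ ha => ⟨(symTensors n ℓ).smul_mem c ha.1, ha.2.smul c⟩

lemma contract_self_eq_zero {a : Tensor n ℓ} (h : contract a a = 0) : a = 0 := by
  have h1 : contract a a = ((∑ I, ‖a I‖ ^ 2 : ℝ) : ℂ) := by
    simp only [contract, Complex.ofReal_sum, Complex.ofReal_pow]
    exact Finset.sum_congr rfl fun I _ => Complex.conj_mul' (a I)
  rw [h1, Complex.ofReal_eq_zero, Finset.sum_eq_zero_iff_of_nonneg fun I _ => by positivity] at h
  funext I
  simpa using h I (Finset.mem_univ I)

/-! ### Splitting off the trace -/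

/-- The symmetrized product `δ_{(A₁A₂} b_{A₃…A_ℓ)}` with the metric, which corresponds to
multiplication of the polynomial by `|x|²`. -/
def metricProd : Tensor n m →ₗ[ℂ] Tensor n (m + 2) where
  toFun b := symmPart fun I => if I 0 = I 1 then b (Fin.tail (Fin.tail I)) else 0
  map_add' a b := by
    funext I
    simp only [symmPart, Pi.add_apply, ← mul_add, ← Finset.sum_add_distrib]
    congr 1
    exact Finset.sum_congr rfl fun σ _ => by split_ifs <;> simp
  map_smul' c a := by
    funext I
    simp only [symmPart, Pi.smul_apply, smul_eq_mul, RingHom.id_apply, Finset.mul_sum]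
    exact Finset.sum_congr rfl fun σ _ => by split_ifs <;> ring

lemma metricProd_apply (b : Tensor n m) : metricProd b =
    symmPart fun I : Fin (m + 2) → Fin (n + 1) =>
      if I 0 = I 1 then b (Fin.tail (Fin.tail I)) else 0 := rfl

/-- Summation of `δ_{AB} b_J` against weights. -/
lemma sum_delta_mul (b : Tensor n m) (w : (Fin (m + 2) → Fin (n + 1)) → ℂ) :
    ∑ I, (if I 0 = I 1 then b (Fin.tail (Fin.tail I)) else 0) * w I
      = ∑ J, b J * ∑ A, w (Fin.cons A (Fin.cons A J)) := by
  rw [sum_cons]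
  simp_rw [sum_cons (ℓ := m)]
  simp only [Fin.cons_zero, Fin.cons_one, Fin.tail_cons, ite_mul, zero_mul]
  have h : ∀ A B : Fin (n + 1), (∑ J : Fin m → Fin (n + 1),
      if A = B then b J * w (Fin.cons A (Fin.cons B J)) else 0)
      = if A = B then ∑ J, b J * w (Fin.cons A (Fin.cons B J)) else 0 := fun A B => by
    split_ifs <;> simp
  simp only [h, Finset.sum_ite_eq, Finset.mem_univ, if_true, Finset.mul_sum]
  rw [Finset.sum_comm]

lemma homPoly_metricProd (b : Tensor n m) (x : Ambient n) :
    homPoly (metricProd b) x = ((‖x‖ ^ 2 : ℝ) : ℂ) * homPoly b x := by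
  rw [metricProd_apply, homPoly_symmPart, homPoly,
    sum_delta_mul b fun I => ∏ k, ((x (I k) : ℝ) : ℂ), homPoly,
    EuclideanSpace.real_norm_sq_eq, Finset.mul_sum]
  refine Finset.sum_congr rfl fun J _ => ?_
  simp only [Fin.prod_univ_succ, Fin.cons_zero, Fin.cons_succ, Complex.ofReal_sum,
    Finset.sum_mul, Finset.mul_sum]
  refine Finset.sum_congr rfl fun A _ => ?_
  push_cast
  ring

lemma Y_metricProd (b : Tensor n m) : Y (metricProd b) = Y b := by
  funext Ω
  rw [← homPoly_coe, homPoly_metricProd]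
  simp [homPoly_coe]

lemma isSymm_metricProd (b : Tensor n m) : IsSymm (metricProd b) := by
  rw [metricProd_apply]
  exact isSymm_symmPart _

lemma sum_metricProd_mul (b : Tensor n m) {w : Tensor n (m + 2)} (hw : IsSymm w) :
    ∑ I, metricProd b I * w I = ∑ J, b J * trace w J := by
  rw [metricProd_apply, sum_symmPart_mul _ hw, sum_delta_mul b w, hw.trace_eq]
  simp only [Finset.sum_apply, slice]

/-- Every symmetric tensor is the sum of a traceless one and a product with the metric; the two
summands are orthogonal for `contract`, so a dimension count gives the splitting, and the
dimension of the traceless part. -/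
lemma symTensors_splitting (n m : ℕ) :
    finrank ℂ (harmonicTensors n (m + 2)) + finrank ℂ (symTensors n m)
        = finrank ℂ (symTensors n (m + 2)) ∧
      harmonicTensors n (m + 2) ⊔ (symTensors n m).map metricProd = symTensors n (m + 2) := by
  set H := harmonicTensors n (m + 2)
  set S := symTensors n (m + 2)
  set S' := symTensors n m
  set D := S'.map (metricProd (n := n) (m := m))
  have hinj : ∀ b ∈ S', metricProd b = 0 → b = 0 := fun b hb h0 => by
    refine eq_zero_of_Y_eq_zero hb fun Ω => ?_
    rw [← Y_metricProd, h0, ← homPoly_coe, homPoly_zero_tensor]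
    rfl
  have hD : finrank ℂ D = finrank ℂ S' := by
    have h : Function.Injective (metricProd.domRestrict S') := by
      rw [← LinearMap.ker_eq_bot, LinearMap.ker_eq_bot']
      exact fun b hb => Subtype.ext (hinj b b.2 hb)
    have h2 := LinearMap.finrank_range_of_inj h
    rwa [LinearMap.range_domRestrict] at h2
  have hle : H ⊔ D ≤ S := by
    refine sup_le (fun a ha => ha.1) ?_
    rintro _ ⟨b, -, rfl⟩
    exact isSymm_metricProd b
  have hdisj : H ⊓ D = ⊥ := by
    rw [eq_bot_iff]
    rintro a ⟨⟨ha, ht⟩, ⟨b, hb, rfl⟩⟩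
    have hs : IsSymm fun I => starRingEnd ℂ (metricProd b I) := fun σ I =>
      congrArg (starRingEnd ℂ) (ha σ I)
    have h1 := sum_metricProd_mul b hs
    have h2 : trace (fun I => starRingEnd ℂ (metricProd b I)) = 0 := by
      funext J
      have := congrArg (starRingEnd ℂ) (congrFun (isTraceless_iff.mp ht) J)
      simpa [trace] using this
    rw [h2] at h1
    refine contract_self_eq_zero ?_
    simpa [contract, mul_comm] using h1
  have hsum := Submodule.finrank_sup_add_finrank_inf_eq H D
  rw [hdisj, finrank_bot, add_zero, hD] at hsum
  -- rank-nullity for the trace on symmetric tensors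
  have hrank : finrank ℂ S ≤ finrank ℂ H + finrank ℂ S' := by
    let T := (traceₗ (n := n) (m := m)).domRestrict S
    have h1 := T.finrank_range_add_finrank_ker
    have h2 : finrank ℂ (LinearMap.range T) ≤ finrank ℂ S' := by
      refine Submodule.finrank_mono ?_
      rintro _ ⟨a, rfl⟩
      exact IsSymm.trace a.2
    have h3 : finrank ℂ (LinearMap.ker T) ≤ finrank ℂ H := by
      let i : LinearMap.ker T →ₗ[ℂ] H :=
        LinearMap.codRestrict H (S.subtype.comp (LinearMap.ker T).subtype)
          fun a => ⟨a.1.2, isTraceless_iff.mpr a.2⟩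
      refine LinearMap.finrank_le_finrank_of_injective (f := i) fun a b hab => ?_
      exact Subtype.ext (Subtype.ext (congrArg (fun c : H => (c : Tensor n (m + 2))) hab))
    omega
  have hmono := Submodule.finrank_mono hle
  have heq : finrank ℂ H + finrank ℂ S' = finrank ℂ S := by omega
  exact ⟨heq, Submodule.eq_of_le_of_finrank_eq hle (by omega)⟩

/-- Symmetric tensors are the functions on multisets of `ℓ` indices. -/
lemma finrank_symTensors (n ℓ : ℕ) : finrank ℂ (symTensors n ℓ) = (n + ℓ).choose ℓ := by
  let q : (Fin ℓ → Fin (n + 1)) → Sym (Fin (n + 1)) ℓ := fun I =>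
    ⟨Finset.univ.val.map I, by simp⟩
  have hq : Function.Surjective q := by
    rintro ⟨s, hs⟩
    obtain ⟨l, rfl⟩ := Quot.exists_rep s
    change l.length = ℓ at hs
    subst hs
    refine ⟨l.get, Subtype.ext ?_⟩
    simp [q, Fin.univ_val_map]
  let Φ : (Sym (Fin (n + 1)) ℓ → ℂ) →ₗ[ℂ] symTensors n ℓ :=
    LinearMap.codRestrict _ (LinearMap.funLeft ℂ ℂ q) fun g σ I => by
      change g (q (I ∘ σ)) = g (q I)
      congr 1
      refine Subtype.ext ?_
      change Finset.univ.val.map (I ∘ σ) = Finset.univ.val.map I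
      rw [← Multiset.map_map]
      congr 1
      exact Multiset.map_univ_val_equiv σ
  have hΦ : Function.Bijective Φ := by
    constructor
    · intro g h hgh
      have := congrArg Subtype.val hgh
      exact LinearMap.funLeft_injective_of_surjective ℂ ℂ q hq this
    · intro a
      refine ⟨fun s => a.1 (Function.surjInv hq s), Subtype.ext (funext fun I => ?_)⟩
      refine IsSymm.eq_of_map_eq a.2 ?_
      exact congrArg Subtype.val (Function.surjInv_eq hq (q I))
  rw [← (LinearEquiv.ofBijective Φ hΦ).finrank_eq, Module.finrank_fintype_fun_eq_card,
    Sym.card_sym_eq_choose]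
  simp [Nat.add_right_comm]

lemma finrank_harmonicTensors_of_le_one (n : ℕ) {ℓ : ℕ} (hℓ : ℓ ≤ 1) :
    finrank ℂ (harmonicTensors n ℓ) = (n + ℓ).choose ℓ := by
  have h : harmonicTensors n ℓ = symTensors n ℓ := by
    ext a
    refine ⟨fun h => h.1, fun h => ⟨h, ?_⟩⟩
    interval_cases ℓ <;> trivial
  rw [h, finrank_symTensors]

lemma finrank_harmonicTensors {n : ℕ} (hn : 1 ≤ n) (ℓ : ℕ) (h : 2 ≤ n + ℓ) :
    (finrank ℂ (harmonicTensors n ℓ) : ℝ)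
      = ((n : ℝ) + 2 * ℓ - 1) * (n + ℓ - 2) ! / ((n - 1) ! * ℓ !) := by
  obtain ⟨k, rfl⟩ : ∃ k, n = k + 1 := ⟨n - 1, by omega⟩
  have hfac : ((k ! : ℕ) : ℝ) ≠ 0 := by exact_mod_cast k.factorial_ne_zero
  match ℓ with
  | 0 =>
    obtain ⟨j, rfl⟩ : ∃ j, k = j + 1 := ⟨k - 1, by omega⟩
    rw [finrank_harmonicTensors_of_le_one _ (by norm_num)]
    have e : j + 1 + 1 + 0 - 2 = j := by omega
    have e2 : j + 1 + 1 - 1 = j + 1 := by omega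
    rw [e, e2, eq_div_iff (by rw [Nat.factorial_zero, Nat.cast_one, mul_one]; exact hfac)]
    simp [Nat.factorial_succ]
  | 1 =>
    rw [finrank_harmonicTensors_of_le_one _ le_rfl]
    have e : k + 1 + 1 - 2 = k := by omega
    have e2 : k + 1 - 1 = k := by omega
    rw [e, e2, eq_div_iff (by simpa using hfac)]
    push_cast
    simp only [Nat.choose_one_right, Nat.factorial_one, Nat.cast_one, mul_one]
    push_cast
    ring
  | m + 2 =>
    have h1 := (symTensors_splitting (k + 1) m).1
    rw [finrank_symTensors, finrank_symTensors] at h1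
    have h2 : (finrank ℂ (harmonicTensors (k + 1) (m + 2)) : ℝ)
        = ((k + 1 + (m + 2)).choose (m + 2) : ℝ) - ((k + 1 + m).choose m : ℝ) := by
      rw [← h1]; push_cast; ring
    have e : k + 1 + (m + 2) - 2 = k + 1 + m := by omega
    have e2 : k + 1 - 1 = k := by omega
    have hm : ((m ! : ℕ) : ℝ) ≠ 0 := by exact_mod_cast m.factorial_ne_zero
    have c1 : ((k + 1 + (m + 2)).choose (m + 2) : ℝ)
        = (k + m + 3) * (k + m + 2) * (k + m + 1) !
          / ((k + 1) * k ! * ((m + 2) * (m + 1) * m !)) := by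
      rw [Nat.cast_choose ℝ (by omega), show k + 1 + (m + 2) - (m + 2) = k + 1 by omega,
        show k + 1 + (m + 2) = k + m + 1 + 1 + 1 by omega]
      simp only [Nat.factorial_succ]
      push_cast
      ring
    have c2 : ((k + 1 + m).choose m : ℝ) = (k + m + 1) ! / ((k + 1) * k ! * m !) := by
      rw [Nat.cast_choose ℝ (by omega), show k + 1 + m - m = k + 1 by omega,
        show k + 1 + m = k + m + 1 by omega]
      simp only [Nat.factorial_succ]
      push_cast
      ring
    rw [h2, c1, c2, e, e2, show k + 1 + m = k + m + 1 by omega]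
    generalize (((k + m + 1) ! : ℕ) : ℝ) = x
    have hk1 : (k : ℝ) + 1 ≠ 0 := by positivity
    have hm1 : (m : ℝ) + 1 ≠ 0 := by positivity
    have hm2 : (m : ℝ) + 2 ≠ 0 := by positivity
    simp only [Nat.factorial_succ]
    push_cast
    field_simp
    ring

end Tensors

/-! ### Polar coordinates and Gaussian integrals -/

section Gaussian

variable {n ℓ m : ℕ}

/-- Integration in polar coordinates of a product of an angular and a radial function. -/
lemma integral_eq_sphere_mul_radial {H : Ambient n → ℂ} {h : Sph n → ℂ} {ρ : ℝ → ℂ}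
    (hH : ∀ (Ω : Sph n) (r : ℝ), 0 < r → H (r • (Ω : Ambient n)) = h Ω * ρ r) :
    ∫ x, H x = (∫ Ω, h Ω ∂surfaceMeasure n) * ∫ r in Set.Ioi (0 : ℝ), (r : ℂ) ^ n * ρ r := by
  have hdim : finrank ℝ (Ambient n) - 1 = n := by simp
  calc
    ∫ x, H x = ∫ x : ({(0)}ᶜ : Set (Ambient n)), H x
        ∂((volume : Measure (Ambient n)).comap (↑)) := by
      rw [integral_subtype_comap (measurableSet_singleton _).compl fun x => H x,
        restrict_compl_singleton]
    _ = ∫ x : Sph n × Set.Ioi (0 : ℝ), h x.1 * ρ x.2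
        ∂(surfaceMeasure n).prod (.volumeIoiPow n) := by
      have hmp := (volume : Measure (Ambient n)).measurePreserving_homeomorphUnitSphereProd
      rw [hdim] at hmp
      rw [← hmp.integral_comp (Homeomorph.measurableEmbedding _)]
      refine integral_congr_ae (Eventually.of_forall fun x => ?_)
      set z := homeomorphUnitSphereProd (Ambient n) x
      have hx : x = (homeomorphUnitSphereProd (Ambient n)).symm z := by simp [z]
      have hx2 : (x : Ambient n) = (z.2 : ℝ) • (z.1 : Ambient n) := by
        rw [hx, homeomorphUnitSphereProd_symm_apply_coe]
      change H (x : Ambient n) = _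
      rw [hx2, hH _ _ z.2.2]
    _ = (∫ Ω, h Ω ∂surfaceMeasure n) * ∫ r : Set.Ioi (0 : ℝ), ρ r ∂(.volumeIoiPow n) :=
      integral_prod_mul h fun r : Set.Ioi (0 : ℝ) => ρ r
    _ = _ := by
      congr 1
      simp only [Measure.volumeIoiPow, ENNReal.ofReal]
      rw [integral_withDensity_eq_integral_smul,
        integral_subtype_comap measurableSet_Ioi fun a : ℝ => Real.toNNReal (a ^ n) • ρ a]
      · refine setIntegral_congr_fun measurableSet_Ioi fun r hr => ?_
        simp only [NNReal.smul_def, Real.coe_toNNReal _ (pow_nonneg (le_of_lt hr) _)]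
        rw [Complex.real_smul]
        push_cast
        ring
      · exact (measurable_subtype_coe.pow_const _).real_toNNReal

/-- The Gaussian weight `exp (-|x|²)`. -/
def gauss (x : Ambient n) : ℂ := ((Real.exp (-‖x‖ ^ 2) : ℝ) : ℂ)

lemma hasFDerivAt_gauss (x : Ambient n) :
    HasFDerivAt (gauss (n := n)) (Complex.ofRealCLM.comp
      (Real.exp (-‖x‖ ^ 2) • -((2 : ℝ) • innerSL ℝ x))) x := by
  have h := ((hasStrictFDerivAt_norm_sq x).hasFDerivAt.fun_neg).exp
  refine HasFDerivAt.comp x Complex.ofRealCLM.hasFDerivAt ?_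
  convert! h using 1
  ext v
  simp [two_mul]

lemma fderiv_gauss_single (x : Ambient n) (A : Fin (n + 1)) :
    fderiv ℝ gauss x (EuclideanSpace.single A 1) = -2 * ((x A : ℝ) : ℂ) * gauss x := by
  rw [(hasFDerivAt_gauss x).fderiv]
  simp [gauss, EuclideanSpace.inner_single_right]
  ring

lemma continuous_gauss : Continuous (gauss (n := n)) := by
  unfold gauss
  fun_prop

/-- Polynomial growth of a function on the ambient space. -/
def PolyGrowth (F : Ambient n → ℂ) : Prop :=
  ∃ (c : ℝ) (k : ℕ), ∀ x, ‖F x‖ ≤ c * (1 + ‖x‖) ^ k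

lemma PolyGrowth.mul {F G : Ambient n → ℂ} (hF : PolyGrowth F) (hG : PolyGrowth G) :
    PolyGrowth fun x => F x * G x := by
  obtain ⟨c, k, h⟩ := hF
  obtain ⟨d, l, h'⟩ := hG
  refine ⟨c * d, k + l, fun x => ?_⟩
  rw [norm_mul, pow_add, mul_mul_mul_comm]
  exact mul_le_mul (h x) (h' x) (norm_nonneg _) ((norm_nonneg _).trans (h x))

lemma abs_coord_le_norm (x : Ambient n) (A : Fin (n + 1)) : |x A| ≤ ‖x‖ :=
  PiLp.norm_apply_le x A

lemma polyGrowth_coord (A : Fin (n + 1)) :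
    PolyGrowth fun x : Ambient n => ((x A : ℝ) : ℂ) := by
  refine ⟨1, 1, fun x => ?_⟩
  rw [Complex.norm_real, Real.norm_eq_abs, one_mul, pow_one]
  linarith [abs_coord_le_norm x A]

lemma polyGrowth_homPoly (a : Tensor n ℓ) : PolyGrowth (homPoly a) := by
  refine ⟨∑ I, ‖a I‖, ℓ, fun x => ?_⟩
  rw [Finset.sum_mul]
  refine (norm_sum_le _ _).trans (Finset.sum_le_sum fun I _ => ?_)
  rw [norm_mul, norm_prod]
  refine mul_le_mul_of_nonneg_left ?_ (norm_nonneg _)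
  calc ∏ k, ‖((x (I k) : ℝ) : ℂ)‖ ≤ ∏ _k : Fin ℓ, (1 + ‖x‖) := by
        refine Finset.prod_le_prod (fun _ _ => norm_nonneg _) fun k _ => ?_
        rw [Complex.norm_real, Real.norm_eq_abs]
        linarith [abs_coord_le_norm x (I k)]
    _ = (1 + ‖x‖) ^ ℓ := by simp

/-- Since `t ^ k ≤ k! exp t`, polynomial growth costs only half of the Gaussian decay. -/
lemma PolyGrowth.integrable_mul_gauss {F : Ambient n → ℂ} (hF : PolyGrowth F)
    (hc : Continuous F) : Integrable fun x => F x * gauss x := by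
  obtain ⟨c, k, h⟩ := hF
  have hc0 : 0 ≤ c := by simpa using (norm_nonneg _).trans (h 0)
  have hint : Integrable fun x : Ambient n => Complex.exp (-(1 / 2 : ℂ) * ‖x‖ ^ 2) := by
    have h := GaussianFourier.integrable_cexp_neg_mul_sq_norm_add (V := Ambient n)
      (b := 1 / 2) (by norm_num) 0 0
    simpa using h
  refine ((hint.norm.const_mul (c * k ! * Real.exp 2))).mono'
    (hc.mul continuous_gauss).aestronglyMeasurable (Eventually.of_forall fun x => ?_)
  have h1 : ‖Complex.exp (-(1 / 2 : ℂ) * ‖x‖ ^ 2)‖ = Real.exp (-(1 / 2) * ‖x‖ ^ 2) := by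
    rw [Complex.norm_exp]
    congr 1
    rw [show -(1 / 2 : ℂ) * (‖x‖ : ℂ) ^ 2 = ((-(1 / 2) * ‖x‖ ^ 2 : ℝ) : ℂ) by push_cast; ring,
      Complex.ofReal_re]
  have h2 : ‖gauss x‖ = Real.exp (-‖x‖ ^ 2) := by
    rw [gauss, Complex.norm_real, Real.norm_of_nonneg (Real.exp_pos _).le]
  have h3 : (1 + ‖x‖) ^ k ≤ k ! * Real.exp (1 + ‖x‖) := by
    have := Real.pow_div_factorial_le_exp (1 + ‖x‖) (by positivity) k
    rwa [div_le_iff₀' (by positivity)] at this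
  rw [norm_mul, h1, h2]
  calc ‖F x‖ * Real.exp (-‖x‖ ^ 2)
      ≤ (c * (k ! * Real.exp (1 + ‖x‖))) * Real.exp (-‖x‖ ^ 2) := by
        gcongr
        exact (h x).trans (mul_le_mul_of_nonneg_left h3 hc0)
    _ = c * k ! * Real.exp ((1 + ‖x‖) + -‖x‖ ^ 2) := by
        rw [Real.exp_add (1 + ‖x‖)]; ring
    _ ≤ c * k ! * Real.exp (2 + -(1 / 2) * ‖x‖ ^ 2) := by
        refine mul_le_mul_of_nonneg_left (Real.exp_le_exp.mpr ?_) (by positivity)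
        -- `r ≤ 1 + r² / 2`
        nlinarith [sq_nonneg (‖x‖ - 1)]
    _ = c * k ! * Real.exp 2 * Real.exp (-(1 / 2) * ‖x‖ ^ 2) := by rw [Real.exp_add]; ring

/-- Integration by parts against the Gaussian weight. -/
lemma two_mul_integral_coord_mul_gauss {F : Ambient n → ℂ} (A : Fin (n + 1))
    (hF : Differentiable ℝ F)
    (h1 : Integrable fun x => fderiv ℝ F x (EuclideanSpace.single A 1) * gauss x)
    (h2 : Integrable fun x => ((x A : ℝ) : ℂ) * F x * gauss x)
    (h3 : Integrable fun x => F x * gauss x) :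
    2 * ∫ x, ((x A : ℝ) : ℂ) * F x * gauss x
      = ∫ x, fderiv ℝ F x (EuclideanSpace.single A 1) * gauss x := by
  have e : (fun x => F x * fderiv ℝ gauss x (EuclideanSpace.single A 1))
      = fun x => -2 * (((x A : ℝ) : ℂ) * F x * gauss x) := by
    funext x
    rw [fderiv_gauss_single]
    ring
  have h := integral_mul_fderiv_eq_neg_fderiv_mul_of_integrable (μ := volume) h1
    (by rw [e]; exact h2.const_mul _) h3 (fun x _ => hF x)
    (fun x _ => (hasFDerivAt_gauss x).differentiableAt)
  rw [e, integral_const_mul] at h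
  linear_combination -h

/-- The Gaussian pairing of two homogeneous polynomials. -/
def gaussPair {ℓ ℓ' : ℕ} (a : Tensor n ℓ) (a' : Tensor n ℓ') : ℂ :=
  ∫ x, homPoly a x * homPoly a' x * gauss x

lemma integrable_gaussPair {ℓ ℓ' : ℕ} (a : Tensor n ℓ) (a' : Tensor n ℓ') :
    Integrable fun x => homPoly a x * homPoly a' x * gauss x :=
  ((polyGrowth_homPoly a).mul (polyGrowth_homPoly a')).integrable_mul_gauss
    ((continuous_homPoly a).mul (continuous_homPoly a'))

lemma sum_fderiv_slice_of_traceless {a : Tensor n (ℓ + 1)} (ha : IsSymm a)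
    (ht : IsTraceless a) (x : Ambient n) :
    ∑ A, fderiv ℝ (homPoly (slice a A)) x (EuclideanSpace.single A 1) = 0 := by
  rcases ℓ with _ | m
  · simp [fderiv_homPoly_rank_zero]
  · simp only [fderiv_homPoly_single (ha.slice _), ← Finset.mul_sum, ← homPoly_sum, ← ha.trace_eq,
      isTraceless_iff.mp ht, homPoly_zero_tensor, Pi.zero_apply, mul_zero]

/-- Moving one factor `x` of a traceless polynomial onto the other polynomial as a derivative. -/
lemma two_mul_gaussPair {ℓ ℓ' : ℕ} {a : Tensor n (ℓ + 1)} (ha : IsSymm a) (ht : IsTraceless a)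
    (a' : Tensor n ℓ')
    (hi : ∀ A, Integrable fun x => homPoly (slice a A) x *
      fderiv ℝ (homPoly a') x (EuclideanSpace.single A 1) * gauss x) :
    2 * gaussPair a a' = ∑ A, ∫ x, homPoly (slice a A) x *
      fderiv ℝ (homPoly a') x (EuclideanSpace.single A 1) * gauss x := by
  have hi1 : ∀ A, Integrable fun x =>
      fderiv ℝ (homPoly (slice a A)) x (EuclideanSpace.single A 1) * homPoly a' x * gauss x := by
    intro A
    rcases ℓ with _ | m
    · simp [fderiv_homPoly_rank_zero]
    · refine ((integrable_gaussPair (slice (slice a A) A) a').const_mul (m + 1 : ℂ)).congr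
        (Eventually.of_forall fun x => ?_)
      simp only [fderiv_homPoly_single (ha.slice _)]
      ring
  have hd : ∀ A x, fderiv ℝ (fun y => homPoly (slice a A) y * homPoly a' y) x
      (EuclideanSpace.single A 1) * gauss x
      = fderiv ℝ (homPoly (slice a A)) x (EuclideanSpace.single A 1) * homPoly a' x * gauss x
        + homPoly (slice a A) x *
          fderiv ℝ (homPoly a') x (EuclideanSpace.single A 1) * gauss x := by
    intro A x
    rw [fderiv_fun_mul (differentiable_homPoly _ x) (differentiable_homPoly _ x)]
    simp only [add_apply, smul_apply, smul_eq_mul]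
    ring
  have hx : ∀ A, Integrable fun x : Ambient n =>
      ((x A : ℝ) : ℂ) * (homPoly (slice a A) x * homPoly a' x) * gauss x := fun A =>
    ((polyGrowth_coord A).mul
      ((polyGrowth_homPoly (slice a A)).mul (polyGrowth_homPoly a'))).integrable_mul_gauss
      ((Complex.continuous_ofReal.comp (EuclideanSpace.proj (𝕜 := ℝ) A).continuous).mul
        ((continuous_homPoly _).mul (continuous_homPoly _)))
  have hA : ∀ A, 2 * ∫ x : Ambient n,
      ((x A : ℝ) : ℂ) * (homPoly (slice a A) x * homPoly a' x) * gauss x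
      = (∫ x, fderiv ℝ (homPoly (slice a A)) x (EuclideanSpace.single A 1)
          * homPoly a' x * gauss x)
        + ∫ x, homPoly (slice a A) x *
          fderiv ℝ (homPoly a') x (EuclideanSpace.single A 1) * gauss x := by
    intro A
    rw [two_mul_integral_coord_mul_gauss (F := fun y => homPoly (slice a A) y * homPoly a' y) A
      ((differentiable_homPoly _).mul (differentiable_homPoly _)) ?_ (hx A)
      (integrable_gaussPair _ _), ← integral_add (hi1 A) (hi A)]
    · exact integral_congr_ae (Eventually.of_forall (hd A))
    · exact ((hi1 A).add (hi A)).congr (Eventually.of_forall fun x => (hd A x).symm)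
  have h0 : ∑ A, ∫ x, fderiv ℝ (homPoly (slice a A)) x (EuclideanSpace.single A 1)
      * homPoly a' x * gauss x = 0 := by
    rw [← integral_finsetSum _ fun A _ => hi1 A]
    simp only [← Finset.sum_mul, sum_fderiv_slice_of_traceless ha ht, zero_mul, integral_zero]
  have hsum : gaussPair a a' = ∑ A, ∫ x : Ambient n,
      ((x A : ℝ) : ℂ) * (homPoly (slice a A) x * homPoly a' x) * gauss x := by
    rw [← integral_finsetSum _ fun A _ => hx A, gaussPair]
    refine integral_congr_ae (Eventually.of_forall fun x => ?_)
    simp only [homPoly_eq_sum_slice a, Finset.sum_mul, mul_assoc]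
  rw [hsum, Finset.mul_sum]
  simp only [hA, Finset.sum_add_distrib, h0, zero_add]

lemma gaussPair_rank_zero_right {a : Tensor n (ℓ + 1)} (ha : IsSymm a) (ht : IsTraceless a)
    (a' : Tensor n 0) : gaussPair a a' = 0 := by
  have h := two_mul_gaussPair ha ht a' (by simp [fderiv_homPoly_rank_zero])
  simpa [fderiv_homPoly_rank_zero] using h

lemma gaussPair_succ {ℓ ℓ' : ℕ} {a : Tensor n (ℓ + 1)} (ha : IsSymm a) (ht : IsTraceless a)
    {a' : Tensor n (ℓ' + 1)} (ha' : IsSymm a') :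
    gaussPair a a' = ((ℓ' + 1 : ℂ) / 2) * ∑ A, gaussPair (slice a A) (slice a' A) := by
  have e : ∀ A, (fun x => homPoly (slice a A) x *
      fderiv ℝ (homPoly a') x (EuclideanSpace.single A 1) * gauss x)
      = fun x => (ℓ' + 1 : ℂ) * (homPoly (slice a A) x * homPoly (slice a' A) x * gauss x) := by
    intro A
    funext x
    rw [fderiv_homPoly_single ha']
    ring
  have h := two_mul_gaussPair ha ht a' fun A => by
    rw [e]; exact (integrable_gaussPair _ _).const_mul _
  simp only [e, integral_const_mul, ← Finset.mul_sum] at h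
  simp only [gaussPair] at h ⊢
  linear_combination (1 / 2 : ℂ) * h

lemma gaussPair_eq_zero_of_lt {ℓ ℓ' : ℕ} (hlt : ℓ' < ℓ) {a : Tensor n ℓ} (ha : IsSymm a)
    (ht : IsTraceless a) {a' : Tensor n ℓ'} (ha' : IsSymm a') : gaussPair a a' = 0 := by
  induction ℓ' generalizing ℓ with
  | zero =>
    obtain ⟨k, rfl⟩ : ∃ k, ℓ = k + 1 := ⟨ℓ - 1, by omega⟩
    exact gaussPair_rank_zero_right ha ht a'
  | succ m ih =>
    obtain ⟨k, rfl⟩ : ∃ k, ℓ = k + 1 := ⟨ℓ - 1, by omega⟩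
    rw [gaussPair_succ ha ht ha', Finset.sum_eq_zero, mul_zero]
    exact fun A _ => ih (by omega) (ha.slice A) (ht.slice ha A) (ha'.slice A)

lemma gaussPair_eq {a a' : Tensor n ℓ} (ha : IsSymm a) (ht : IsTraceless a) (ha' : IsSymm a') :
    gaussPair a a' = ((ℓ ! / 2 ^ ℓ * Real.pi ^ (((n : ℝ) + 1) / 2) : ℝ) : ℂ)
      * ∑ I, a I * a' I := by
  induction ℓ with
  | zero =>
    have h1 : ∫ x : Ambient n, gauss x = ((Real.pi ^ (((n : ℝ) + 1) / 2) : ℝ) : ℂ) := by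
      have := GaussianFourier.integral_rexp_neg_mul_sq_norm (V := Ambient n) (b := 1) one_pos
      simp only [gauss]
      rw [integral_complex_ofReal]
      simpa using this
    simp only [gaussPair, homPoly_rank_zero, integral_const_mul, h1]
    simp [Subsingleton.elim default ![]]
    ring
  | succ ℓ ih =>
    rw [gaussPair_succ ha ht ha', sum_cons]
    simp only [ih (ha.slice _) (ht.slice ha _) (ha'.slice _), ← Finset.mul_sum, slice]
    rw [Nat.factorial_succ]
    push_cast
    ring

/-- The radial factor `∫₀^∞ r^{n+d} exp (-r²) dr`. -/
lemma integral_radial_gauss (n d : ℕ) :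
    ∫ r in Set.Ioi (0 : ℝ), (r : ℂ) ^ n * ((r : ℂ) ^ d * ((Real.exp (-r ^ 2) : ℝ) : ℂ))
      = ((1 / 2 * Real.Gamma (((n : ℝ) + d + 1) / 2) : ℝ) : ℂ) := by
  have h := integral_rpow_mul_exp_neg_rpow (p := 2) (q := n + d) two_pos
    (by have : (0 : ℝ) ≤ n + d := by positivity
        linarith)
  rw [← h, ← integral_complex_ofReal]
  refine setIntegral_congr_fun measurableSet_Ioi fun r hr => ?_
  have h1 : r ^ ((n : ℝ) + d) = r ^ n * r ^ d := by
    rw [← pow_add, ← Real.rpow_natCast]; push_cast; rfl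
  simp only [h1, Real.rpow_two]
  push_cast
  ring

lemma gaussPair_eq_integral_sphere {ℓ ℓ' : ℕ} (a : Tensor n ℓ) (a' : Tensor n ℓ') :
    gaussPair a a' = (∫ Ω, Y a Ω * Y a' Ω ∂surfaceMeasure n)
      * ((1 / 2 * Real.Gamma (((n : ℝ) + (ℓ + ℓ' : ℕ) + 1) / 2) : ℝ) : ℂ) := by
  rw [gaussPair, ← integral_radial_gauss]
  refine integral_eq_sphere_mul_radial
    (ρ := fun r => (r : ℂ) ^ (ℓ + ℓ') * ((Real.exp (-r ^ 2) : ℝ) : ℂ)) fun Ω r hr => ?_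
  rw [homPoly_smul_arg, homPoly_smul_arg, homPoly_coe, homPoly_coe, gauss, norm_smul,
    norm_eq_of_mem_sphere, Real.norm_of_nonneg hr.le, mul_one]
  ring

lemma radial_gamma_ne_zero (n d : ℕ) :
    ((1 / 2 * Real.Gamma (((n : ℝ) + d + 1) / 2) : ℝ) : ℂ) ≠ 0 := by
  have : 0 < Real.Gamma (((n : ℝ) + d + 1) / 2) := Real.Gamma_pos_of_pos (by positivity)
  exact_mod_cast (by positivity : (1 / 2 * Real.Gamma (((n : ℝ) + d + 1) / 2)) ≠ 0)

/-- The tensor with complex conjugate components. -/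
def conjTensor (a : Tensor n ℓ) : Tensor n ℓ := fun I => starRingEnd ℂ (a I)

lemma IsSymm.conj {a : Tensor n ℓ} (ha : IsSymm a) : IsSymm (conjTensor a) := fun σ I =>
  congrArg (starRingEnd ℂ) (ha σ I)

lemma IsTraceless.conj {a : Tensor n ℓ} (ha : IsTraceless a) :
    IsTraceless (conjTensor a) := by
  match ℓ, a, ha with
  | 0, _, _ => trivial
  | 1, _, _ => trivial
  | m + 2, a, ha =>
    intro J
    have := congrArg (starRingEnd ℂ) (ha J)
    simpa [conjTensor] using this

lemma conj_Y (a : Tensor n ℓ) (Ω : Sph n) : starRingEnd ℂ (Y a Ω) = Y (conjTensor a) Ω := by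
  simp [Y, conjTensor]

theorem integral_conj_Y_mul_Y {a a' : Tensor n ℓ} (ha : IsSymm a) (ht : IsTraceless a)
    (ha' : IsSymm a') :
    ∫ Ω, starRingEnd ℂ (Y a Ω) * Y a' Ω ∂(surfaceMeasure n)
      = (C n ℓ : ℂ) * contract a a' := by
  have h1 := gaussPair_eq_integral_sphere (conjTensor a) a'
  rw [gaussPair_eq ha.conj ht.conj ha'] at h1
  simp only [conj_Y]
  have hG : Real.Gamma (((n : ℝ) + 1) / 2 + ℓ) ≠ 0 := (Real.Gamma_pos_of_pos (by positivity)).ne'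
  have e : ((n : ℝ) + (ℓ + ℓ : ℕ) + 1) / 2 = ((n : ℝ) + 1) / 2 + ℓ := by push_cast; ring
  refine mul_right_cancel₀ (radial_gamma_ne_zero n (ℓ + ℓ)) ?_
  rw [← h1, e, contract]
  have hC : ((ℓ ! / 2 ^ ℓ * Real.pi ^ (((n : ℝ) + 1) / 2) : ℝ) : ℂ) = (C n ℓ : ℂ)
      * ((1 / 2 * Real.Gamma (((n : ℝ) + 1) / 2 + ℓ) : ℝ) : ℂ) := by
    rw [← Complex.ofReal_mul, C]
    congr 1
    field_simp
  rw [hC]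
  simp only [conjTensor]
  ring

theorem integral_conj_Y_mul_Y_eq_zero {ℓ ℓ' : ℕ} {a : Tensor n ℓ} {a' : Tensor n ℓ'}
    (hne : ℓ ≠ ℓ') (ha : IsSymm a) (ht : IsTraceless a) (ha' : IsSymm a')
    (ht' : IsTraceless a') :
    ∫ Ω, starRingEnd ℂ (Y a Ω) * Y a' Ω ∂(surfaceMeasure n) = 0 := by
  simp only [conj_Y]
  rcases lt_or_gt_of_ne hne with h | h
  · have h1 := gaussPair_eq_integral_sphere a' (conjTensor a)
    rw [gaussPair_eq_zero_of_lt h ha' ht' ha.conj] at h1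
    have h2 := (mul_eq_zero.mp h1.symm).resolve_right (radial_gamma_ne_zero n (ℓ' + ℓ))
    simpa only [mul_comm] using h2
  · have h1 := gaussPair_eq_integral_sphere (conjTensor a) a'
    rw [gaussPair_eq_zero_of_lt h ha.conj ht.conj ha'] at h1
    exact (mul_eq_zero.mp h1.symm).resolve_right (radial_gamma_ne_zero n (ℓ + ℓ'))

end Gaussian

/-! ### Symmetry of the Laplace-Beltrami operator -/

section Green

variable {n : ℕ}

/-- The extension of a function on the sphere that is constant on open rays from the origin
(with the value `0` at the origin). -/
def radialExt (f : Sph n → ℂ) (x : Ambient n) : ℂ :=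
  if hx : x = 0 then 0 else
    f ⟨‖x‖⁻¹ • x, by simp [norm_smul, norm_ne_zero_iff.mpr hx]⟩

lemma radialExt_smul_coe (f : Sph n → ℂ) (Ω : Sph n) {r : ℝ} (hr : 0 < r) :
    radialExt f (r • (Ω : Ambient n)) = f Ω := by
  have h0 : r • (Ω : Ambient n) ≠ 0 := smul_ne_zero hr.ne' (ne_zero_of_mem_unit_sphere Ω)
  rw [radialExt, dif_neg h0]
  congr 1
  ext1
  simp [norm_smul, abs_of_pos hr, smul_smul, hr.ne']

lemma radialExt_coe (f : Sph n → ℂ) (Ω : Sph n) : radialExt f (Ω : Ambient n) = f Ω := by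
  have := radialExt_smul_coe f Ω one_pos
  rwa [one_smul] at this

lemma exists_eq_smul_coe {x : Ambient n} (hx : x ≠ 0) :
    ∃ (r : ℝ) (Ω : Sph n), 0 < r ∧ x = r • (Ω : Ambient n) :=
  have h0 : ‖x‖ ≠ 0 := norm_ne_zero_iff.mpr hx
  ⟨‖x‖, ⟨‖x‖⁻¹ • x, by simp [norm_smul, h0]⟩, norm_pos_iff.mpr hx, by simp [smul_smul, h0]⟩

lemma radialExt_smul (f : Sph n → ℂ) (x : Ambient n) {r : ℝ} (hr : 0 < r) :
    radialExt f (r • x) = radialExt f x := by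
  rcases eq_or_ne x 0 with rfl | hx
  · rw [smul_zero]
  · obtain ⟨s, Ω, hs, rfl⟩ := exists_eq_smul_coe hx
    rw [smul_smul, radialExt_smul_coe f Ω hs, radialExt_smul_coe f Ω (mul_pos hr hs)]

/-- Near `x` the extension is `f` in the chart at `x / |x|`, composed with the stereographic
projection, which is smooth as an ambient function. -/
lemma contDiffAt_radialExt {f : Sph n → ℂ} (hf : ContMDiff (𝓡 n) 𝓘(ℝ, ℂ) ∞ f) {x : Ambient n}
    (hx : x ≠ 0) : ContDiffAt ℝ ∞ (radialExt f) x := by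
  have := Fact.mk (@finrank_euclideanSpace_fin ℝ _ (n + 1))
  obtain ⟨r, p, hr, hxp⟩ := exists_eq_smul_coe hx
  have hnx : ‖x‖⁻¹ • x = p := by
    rw [hxp]
    simp [norm_smul, abs_of_pos hr, smul_smul, hr.ne']
  let U := (OrthonormalBasis.fromOrthogonalSpanSingleton (𝕜 := ℝ) n
    (ne_zero_of_mem_unit_sphere (-p))).repr
  let e := chartAt (EuclideanSpace ℝ (Fin n)) p
  have he : ∀ q : Sph n, e q = U (stereoToFun ((-p : Sph n) : Ambient n) (q : Ambient n)) :=
    fun q => rfl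
  have hnorm : ContDiffAt ℝ ∞ (fun y : Ambient n => ‖y‖⁻¹ • y) x :=
    ((contDiffAt_norm ℝ hx).inv (norm_ne_zero_iff.mpr hx)).smul contDiffAt_id
  have hst : ContDiffAt ℝ ∞ (stereoToFun ((-p : Sph n) : Ambient n)) (‖x‖⁻¹ • x) := by
    refine contDiffOn_stereoToFun.contDiffAt (IsOpen.mem_nhds ?_ ?_)
    · exact isOpen_ne_fun (innerSL ℝ ((-p : Sph n) : Ambient n)).continuous continuous_const
    · rw [hnx, Set.mem_ofPred_eq]
      change inner ℝ (-(p : Ambient n)) (p : Ambient n) ≠ 1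
      rw [inner_neg_left, real_inner_self_eq_norm_sq, norm_eq_of_mem_sphere]
      norm_num
  have hg : ContDiffAt ℝ ∞ (fun y => f (e.symm y))
      (U (stereoToFun ((-p : Sph n) : Ambient n) (‖x‖⁻¹ • x))) := by
    rw [hnx, ← he p]
    exact contDiffAt_chart hf p
  have hU : ContDiffAt ℝ ∞ U (stereoToFun ((-p : Sph n) : Ambient n) (‖x‖⁻¹ • x)) :=
    U.contDiff.contDiffAt
  have hcomp : ContDiffAt ℝ ∞ (fun y : Ambient n => f (e.symm
      (U (stereoToFun ((-p : Sph n) : Ambient n) (‖y‖⁻¹ • y))))) x :=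
    ContDiffAt.comp x (g := fun y => f (e.symm y))
      (f := fun y : Ambient n => U (stereoToFun ((-p : Sph n) : Ambient n) (‖y‖⁻¹ • y))) hg
      (ContDiffAt.comp x (g := fun w => U w)
        (f := fun y : Ambient n => stereoToFun ((-p : Sph n) : Ambient n) (‖y‖⁻¹ • y)) hU
        (ContDiffAt.comp x (g := stereoToFun ((-p : Sph n) : Ambient n))
          (f := fun y : Ambient n => ‖y‖⁻¹ • y) hst hnorm))
  refine hcomp.congr_of_eventuallyEq ?_
  have hne : ∀ᶠ y in 𝓝 x, ‖y‖⁻¹ • y ≠ -(p : Ambient n) := by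
    refine hnorm.continuousAt.eventually_ne ?_
    rw [hnx]
    exact fun h => ne_neg_of_mem_unit_sphere ℝ p (Subtype.ext h)
  filter_upwards [hne, eventually_ne_nhds hx] with y hy hy0
  obtain ⟨s, q, hs, rfl⟩ := exists_eq_smul_coe hy0
  have hq : ‖s • (q : Ambient n)‖⁻¹ • s • (q : Ambient n) = q := by
    simp [norm_smul, abs_of_pos hs, smul_smul, hs.ne']
  rw [hq] at hy ⊢
  rw [radialExt_smul_coe f q hs, ← he q, e.left_inv]
  change q ∈ (stereographic' n (-p)).source
  rw [stereographic'_source]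
  exact fun h => hy (congrArg Subtype.val h)

lemma laplacian_eq_laplacian_radialExt {f : Sph n → ℂ} (hf : ContMDiff (𝓡 n) 𝓘(ℝ, ℂ) ∞ f)
    (p : Sph n) : laplacian f p = Laplacian.laplacian (radialExt f) (p : Ambient n) := by
  have h := laplacian_restrict_of_homogeneous (f := f) (F := radialExt f) p 0
    ((contDiffAt_radialExt hf (ne_zero_of_mem_unit_sphere p)).of_le (by norm_cast))
    (radialExt_coe f) (by
      filter_upwards [eventually_gt_nhds one_pos] with t ht
      rw [radialExt_smul _ _ ht]
      simp)
  simpa using h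

/-- The Laplacian of a ray-wise constant function is homogeneous of degree `-2`. -/
lemma laplacian_radialExt_smul {f : Sph n → ℂ} (hf : ContMDiff (𝓡 n) 𝓘(ℝ, ℂ) ∞ f)
    (p : Sph n) {r : ℝ} (hr : 0 < r) :
    Laplacian.laplacian (radialExt f) (r • (p : Ambient n)) = ((r ^ 2)⁻¹ : ℝ) * laplacian f p := by
  set F := radialExt f
  have h1 : fderiv ℝ F = fun y => r • fderiv ℝ F (r • y) := by
    funext y
    rw [← fderiv_comp_smul]
    congr 1
    exact funext fun z => (radialExt_smul f z hr).symm
  have hd : DifferentiableAt ℝ (fun y => fderiv ℝ F (r • y)) (p : Ambient n) := by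
    have h2 : DifferentiableAt ℝ (fderiv ℝ F) (r • (p : Ambient n)) :=
      ((contDiffAt_radialExt hf
        (smul_ne_zero hr.ne' (ne_zero_of_mem_unit_sphere p))).fderiv_right
          (m := 1) (by norm_cast)).differentiableAt one_ne_zero
    exact h2.comp (p : Ambient n) (differentiableAt_id.const_smul r)
  have h2 : fderiv ℝ (fderiv ℝ F) (p : Ambient n)
      = r • r • fderiv ℝ (fderiv ℝ F) (r • (p : Ambient n)) := by
    conv_lhs => rw [h1]
    rw [fderiv_fun_const_smul hd, fderiv_comp_smul]
  rw [laplacian_eq_laplacian_radialExt hf,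
    laplacian_eq_sum_fderiv _ (EuclideanSpace.basisFun _ ℝ),
    laplacian_eq_sum_fderiv _ (EuclideanSpace.basisFun _ ℝ), h2, Finset.mul_sum]
  refine Finset.sum_congr rfl fun A _ => ?_
  simp only [smul_apply, Complex.real_smul]
  have : (r : ℂ) ≠ 0 := by exact_mod_cast hr.ne'
  push_cast
  field_simp

lemma fderiv_radialExt_self {f : Sph n → ℂ} (hf : ContMDiff (𝓡 n) 𝓘(ℝ, ℂ) ∞ f)
    {x : Ambient n} (hx : x ≠ 0) : fderiv ℝ (radialExt f) x x = 0 := by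
  have h1 : DifferentiableAt ℝ (radialExt f) ((1 : ℝ) • x) := by
    rw [one_smul]
    exact (contDiffAt_radialExt hf hx).differentiableAt (by norm_num)
  have h2 : HasDerivAt (fun s : ℝ => s • x) x 1 := by
    simpa using (hasDerivAt_id (1 : ℝ)).smul_const x
  have h3 := h1.hasFDerivAt.comp_hasDerivAt (1 : ℝ) h2
  rw [one_smul] at h3
  refine h3.unique ((hasDerivAt_const (1 : ℝ) (radialExt f x)).congr_of_eventuallyEq ?_)
  filter_upwards [eventually_gt_nhds one_pos] with t ht
  exact radialExt_smul f x ht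

/-- The profile of the radial cutoff, as a function of the squared norm. -/
def cutoffProfile : ContDiffBump (1 : ℝ) := ⟨1 / 4, 1 / 2, by norm_num, by norm_num⟩

/-- A smooth radial function supported in an annulus around the unit sphere. -/
def cutoff (x : Ambient n) : ℝ := cutoffProfile (‖x‖ ^ 2)

lemma contDiff_cutoff : ContDiff ℝ ∞ (cutoff (n := n)) :=
  cutoffProfile.contDiff.comp (contDiff_norm_sq ℝ)

lemma cutoff_eventually_zero : cutoff (n := n) =ᶠ[𝓝 0] 0 := by
  have h : ∀ᶠ x : Ambient n in 𝓝 0, ‖x‖ ^ 2 < 1 / 2 := by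
    have hc : ContinuousAt (fun x : Ambient n => ‖x‖ ^ 2) 0 := by fun_prop
    exact hc.eventually_lt_const (by norm_num)
  filter_upwards [h] with x hx
  refine cutoffProfile.zero_of_le_dist ?_
  rw [Real.dist_eq, abs_sub_comm, abs_of_pos (by linarith)]
  change (1 / 2 : ℝ) ≤ _
  linarith

lemma hasCompactSupport_cutoff : HasCompactSupport (cutoff (n := n)) := by
  refine HasCompactSupport.intro (isCompact_closedBall (0 : Ambient n) 2) fun x hx => ?_
  have h2 : 2 < ‖x‖ := by simpa using hx
  refine cutoffProfile.zero_of_le_dist ?_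
  rw [Real.dist_eq, abs_of_pos (by nlinarith)]
  change (1 / 2 : ℝ) ≤ _
  nlinarith

/-- A function vanishing near the origin makes the product with a function that is regular
off the origin regular. -/
lemma contDiff_mul_of_eventually_zero {k : ℕ∞ω} {w v : Ambient n → ℂ}
    (hw : ∀ x, x ≠ 0 → ContDiffAt ℝ k w x) (h0 : w =ᶠ[𝓝 0] 0)
    (hv : ∀ x, x ≠ 0 → ContDiffAt ℝ k v x) : ContDiff ℝ k fun x => w x * v x := by
  rw [contDiff_iff_contDiffAt]
  intro x
  rcases eq_or_ne x 0 with rfl | hx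
  · refine (contDiffAt_const (c := (0 : ℂ))).congr_of_eventuallyEq ?_
    filter_upwards [h0] with y hy
    rw [hy, Pi.zero_apply, zero_mul]
  · exact (hw x hx).mul (hv x hx)

lemma integrable_mul_of_eventually_zero {w v : Ambient n → ℂ}
    (hw : ContDiff ℝ 0 w) (h0 : w =ᶠ[𝓝 0] 0) (hs : HasCompactSupport w)
    (hv : ∀ x, x ≠ 0 → ContDiffAt ℝ 0 v x) : Integrable fun x => w x * v x :=
  (contDiff_mul_of_eventually_zero (fun _ _ => hw.contDiffAt) h0
    hv).continuous.integrable_of_hasCompactSupport hs.mul_right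

/-- The cutoff as a complex function. -/
def cutoffC (x : Ambient n) : ℂ := (cutoff x : ℂ)

lemma contDiff_cutoffC : ContDiff ℝ ∞ (cutoffC (n := n)) :=
  Complex.ofRealCLM.contDiff.comp contDiff_cutoff

lemma cutoffC_eventually_zero : cutoffC (n := n) =ᶠ[𝓝 0] 0 := by
  filter_upwards [cutoff_eventually_zero] with x hx
  simp [cutoffC, hx]

lemma hasCompactSupport_cutoffC : HasCompactSupport (cutoffC (n := n)) :=
  hasCompactSupport_cutoff.comp_left (g := fun t : ℝ => (t : ℂ)) Complex.ofReal_zero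

/-- The gradient of the cutoff is radial. -/
lemma exists_fderiv_cutoffC (x : Ambient n) :
    ∃ c : ℂ, ∀ v, fderiv ℝ cutoffC x v = c * (inner ℝ x v : ℝ) := by
  have h1 : HasFDerivAt (fun y : Ambient n => ‖y‖ ^ 2) (2 • innerSL ℝ x) x :=
    (hasStrictFDerivAt_norm_sq x).hasFDerivAt
  have h2 : HasDerivAt cutoffProfile (deriv cutoffProfile (‖x‖ ^ 2)) (‖x‖ ^ 2) :=
    ((cutoffProfile.contDiff (n := 1)).differentiable one_ne_zero _).hasDerivAt
  have h3 := Complex.ofRealCLM.hasFDerivAt.comp x (h2.comp_hasFDerivAt x h1)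
  refine ⟨((deriv cutoffProfile (‖x‖ ^ 2) * 2 : ℝ) : ℂ), fun v => ?_⟩
  have h4 : fderiv ℝ cutoffC x = _ := h3.fderiv
  rw [h4]
  simp
  ring

lemma eq_sum_coord_smul_single (x : Ambient n) :
    x = ∑ A, x A • EuclideanSpace.single A (1 : ℝ) := by
  have := (EuclideanSpace.basisFun (Fin (n + 1)) ℝ).sum_repr x
  simpa using this.symm

lemma sum_fderiv_cutoffC_mul {f : Sph n → ℂ} (hf : ContMDiff (𝓡 n) 𝓘(ℝ, ℂ) ∞ f)
    {x : Ambient n} (hx : x ≠ 0) :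
    ∑ A, fderiv ℝ cutoffC x (EuclideanSpace.single A 1)
      * fderiv ℝ (radialExt f) x (EuclideanSpace.single A 1) = 0 := by
  obtain ⟨c, hc⟩ := exists_fderiv_cutoffC x
  have h1 := fderiv_radialExt_self hf hx
  have h2 : fderiv ℝ (radialExt f) x x
      = ∑ A, ((x A : ℝ) : ℂ) * fderiv ℝ (radialExt f) x (EuclideanSpace.single A 1) := by
    conv_lhs => rw [eq_sum_coord_smul_single x, ← eq_sum_coord_smul_single x]
    conv_lhs => enter [2]; rw [eq_sum_coord_smul_single x]
    simp [map_sum]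
  rw [h1] at h2
  simp only [hc, EuclideanSpace.inner_single_right, mul_assoc, ← Finset.mul_sum]
  simp [← h2]

/-- Green's formula for ray-wise constant functions, weighted by the cutoff: the derivative of
the cutoff does not contribute since it is radial. -/
lemma integral_cutoff_mul_laplacian {f g : Sph n → ℂ} (hf : ContMDiff (𝓡 n) 𝓘(ℝ, ℂ) ∞ f)
    (hg : ContMDiff (𝓡 n) 𝓘(ℝ, ℂ) ∞ g) :
    ∫ x, cutoffC x * radialExt g x * Laplacian.laplacian (radialExt f) x
      = -∫ x, cutoffC x * ∑ A, fderiv ℝ (radialExt g) x (EuclideanSpace.single A 1)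
          * fderiv ℝ (radialExt f) x (EuclideanSpace.single A 1) := by
  set F := radialExt f
  set G := radialExt g
  have hF : ∀ x, x ≠ 0 → ContDiffAt ℝ ∞ F x := fun x hx => contDiffAt_radialExt hf hx
  have hG : ∀ x, x ≠ 0 → ContDiffAt ℝ ∞ G x := fun x hx => contDiffAt_radialExt hg hx
  set u : Ambient n → ℂ := fun x => cutoffC x * G x with hu
  have hud : ContDiff ℝ ∞ u :=
    contDiff_mul_of_eventually_zero (fun x _ => contDiff_cutoffC.contDiffAt)
      cutoffC_eventually_zero hG
  have hu0 : u =ᶠ[𝓝 0] 0 := by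
    filter_upwards [cutoffC_eventually_zero] with x hx
    simp [hu, hx]
  have hus : HasCompactSupport u := hasCompactSupport_cutoffC.mul_right
  have hpd : ∀ H : Ambient n → ℂ, (∀ x, x ≠ 0 → ContDiffAt ℝ ∞ H x) → ∀ A x, x ≠ 0 →
      ContDiffAt ℝ ∞ (fun y => fderiv ℝ H y (EuclideanSpace.single A 1)) x :=
    fun H hH A x hx => ((hH x hx).fderiv_right (m := ∞) (by norm_cast)).clm_apply contDiffAt_const
  set F' : Fin (n + 1) → Ambient n → ℂ := fun A y => fderiv ℝ F y (EuclideanSpace.single A 1)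
    with hF'
  have hF'd : ∀ A x, x ≠ 0 → ContDiffAt ℝ ∞ (F' A) x := hpd F hF
  set u' : Fin (n + 1) → Ambient n → ℂ := fun A y => fderiv ℝ u y (EuclideanSpace.single A 1)
    with hu'
  have hu'd : ∀ A, ContDiff ℝ 0 (u' A) := fun A =>
    (hud.fderiv_right (m := 0) (by norm_cast)).clm_apply contDiff_const
  have hu'0 : ∀ A, u' A =ᶠ[𝓝 0] 0 := fun A => by
    filter_upwards [eventually_eventually_nhds.mpr hu0] with x hx
    have : fderiv ℝ u x = 0 := by
      rw [(show u =ᶠ[𝓝 x] fun _ => 0 from hx).fderiv_eq]; simp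
    simp [hu', this]
  have hu's : ∀ A, HasCompactSupport (u' A) := fun A => hus.fderiv_apply (𝕜 := ℝ) _
  have hi1 : ∀ A, Integrable fun x => u x * fderiv ℝ (F' A) x (EuclideanSpace.single A 1) :=
    fun A => integrable_mul_of_eventually_zero (hud.of_le (by simp)) hu0 hus
      fun x hx => (hpd _ (hF'd A) A x hx).of_le (by simp)
  have hi2 : ∀ A, Integrable fun x => u' A x * F' A x :=
    fun A => integrable_mul_of_eventually_zero (hu'd A) (hu'0 A) (hu's A)
      fun x hx => (hF'd A x hx).of_le (by simp)
  have hsupp : ∀ x ∈ tsupport u, x ≠ 0 := by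
    rintro x hx rfl
    exact (notMem_tsupport_iff_eventuallyEq.mpr hu0) hx
  have hibp : ∀ A, ∫ x, u x * fderiv ℝ (F' A) x (EuclideanSpace.single A 1)
      = -∫ x, u' A x * F' A x := fun A =>
    integral_mul_fderiv_eq_neg_fderiv_mul_of_integrable (hi2 A) (hi1 A)
      (integrable_mul_of_eventually_zero (hud.of_le (by simp)) hu0 hus
        fun x hx => (hF'd A x hx).of_le (by simp))
      (fun x _ => hud.differentiable (by norm_num) x)
      (fun x hx => (hF'd A x (hsupp x hx)).differentiableAt (by norm_num))
  have hlap : ∀ x, u x * Laplacian.laplacian F x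
      = ∑ A, u x * fderiv ℝ (F' A) x (EuclideanSpace.single A 1) := by
    intro x
    rcases eq_or_ne x 0 with rfl | hx
    · simp [hu0.self_of_nhds]
    · rw [laplacian_eq_sum_fderiv _ (EuclideanSpace.basisFun _ ℝ), Finset.mul_sum]
      refine Finset.sum_congr rfl fun A _ => ?_
      congr 1
      have h1 : DifferentiableAt ℝ (fderiv ℝ F) x :=
        ((hF x hx).fderiv_right (m := 1) (by norm_cast)).differentiableAt one_ne_zero
      have h2 := (h1.hasFDerivAt.clm_apply
        (hasFDerivAt_const (EuclideanSpace.single A (1 : ℝ)) x)).fderiv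
      rw [hF', h2]
      simp
  have hgrad : ∀ x, ∑ A, u' A x * F' A x = cutoffC x *
      ∑ A, fderiv ℝ G x (EuclideanSpace.single A 1) * F' A x := by
    intro x
    rcases eq_or_ne x 0 with rfl | hx
    · simp [(hu'0 _).self_of_nhds, cutoffC_eventually_zero.self_of_nhds]
    · have h1 : ∀ A, u' A x = fderiv ℝ cutoffC x (EuclideanSpace.single A 1) * G x
          + cutoffC x * fderiv ℝ G x (EuclideanSpace.single A 1) := fun A => by
        rw [hu', hu]
        simp only
        rw [fderiv_fun_mul (contDiff_cutoffC.differentiable (by norm_num) x)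
          ((hG x hx).differentiableAt (by norm_num))]
        simp only [add_apply, smul_apply, smul_eq_mul]
        ring
      have h2 := sum_fderiv_cutoffC_mul hf hx
      simp only [h1, add_mul, Finset.sum_add_distrib, Finset.mul_sum, mul_assoc]
      have h3 : ∑ A, fderiv ℝ cutoffC x (EuclideanSpace.single A 1) * (G x * F' A x)
          = G x * ∑ A, fderiv ℝ cutoffC x (EuclideanSpace.single A 1) * F' A x := by
        rw [Finset.mul_sum]
        exact Finset.sum_congr rfl fun A _ => by ring
      rw [h3, h2, mul_zero, zero_add]
  refine Eq.trans ?_ (congrArg Neg.neg (integral_congr_ae (Eventually.of_forall hgrad)))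
  rw [integral_finsetSum _ fun A _ => hi2 A, ← Finset.sum_neg_distrib]
  simp only [← hibp]
  rw [← integral_finsetSum _ fun A _ => hi1 A]
  exact integral_congr_ae (Eventually.of_forall hlap)

/-- The radial factor of the weighted Green formula. -/
def cutoffRadial (r : ℝ) : ℂ := ((cutoffProfile (r ^ 2) * (r ^ 2)⁻¹ : ℝ) : ℂ)

lemma cutoff_smul_coe (Ω : Sph n) (r : ℝ) :
    cutoff (r • (Ω : Ambient n)) = cutoffProfile (r ^ 2) := by
  rw [cutoff, norm_smul, norm_eq_of_mem_sphere, mul_one, Real.norm_eq_abs, sq_abs]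

/-- Up to the area of the sphere this is the integral of a nonzero nonnegative function. -/
lemma integral_cutoffRadial_ne_zero (n : ℕ) :
    ∫ r in Set.Ioi (0 : ℝ), (r : ℂ) ^ n * cutoffRadial r ≠ 0 := by
  have h := integral_eq_sphere_mul_radial (n := n)
    (H := fun x => ((cutoff x * (‖x‖ ^ 2)⁻¹ : ℝ) : ℂ)) (h := fun _ => 1) (ρ := cutoffRadial)
    fun Ω r hr => by
      simp only [cutoff_smul_coe, norm_smul, norm_eq_of_mem_sphere, mul_one, Real.norm_eq_abs,
        sq_abs, one_mul]
      rfl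
  rw [integral_complex_ofReal] at h
  intro h0
  rw [h0, mul_zero, Complex.ofReal_eq_zero] at h
  refine absurd h (ne_of_gt ?_)
  refine Continuous.integral_pos_of_hasCompactSupport_nonneg_nonzero
    (x := EuclideanSpace.single 0 1) ?_ hasCompactSupport_cutoff.mul_right
    (fun x => mul_nonneg cutoffProfile.nonneg (by positivity)) ?_
  · rw [continuous_iff_continuousAt]
    intro x
    rcases eq_or_ne x 0 with rfl | hx
    · refine (continuousAt_const (y := (0 : ℝ))).congr ?_
      filter_upwards [cutoff_eventually_zero] with y hy
      simp [hy]
    · refine contDiff_cutoff.continuous.continuousAt.mul (ContinuousAt.inv₀ (by fun_prop) ?_)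
      exact pow_ne_zero 2 (norm_ne_zero_iff.mpr hx)
  · have h1 : cutoffProfile (1 : ℝ) = 1 :=
      cutoffProfile.one_of_mem_closedBall (by simp [cutoffProfile])
    simp [cutoff, h1]

/-- The Laplace-Beltrami operator is symmetric on smooth functions. -/
theorem integral_mul_laplacian_comm {f g : Sph n → ℂ} (hf : ContMDiff (𝓡 n) 𝓘(ℝ, ℂ) ∞ f)
    (hg : ContMDiff (𝓡 n) 𝓘(ℝ, ℂ) ∞ g) :
    ∫ Ω, g Ω * laplacian f Ω ∂surfaceMeasure n = ∫ Ω, f Ω * laplacian g Ω ∂surfaceMeasure n := by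
  have hpolar : ∀ {f g : Sph n → ℂ}, ContMDiff (𝓡 n) 𝓘(ℝ, ℂ) ∞ f →
      ContMDiff (𝓡 n) 𝓘(ℝ, ℂ) ∞ g →
      ∫ x, cutoffC x * radialExt g x * Laplacian.laplacian (radialExt f) x
        = (∫ Ω, g Ω * laplacian f Ω ∂surfaceMeasure n)
          * ∫ r in Set.Ioi (0 : ℝ), (r : ℂ) ^ n * cutoffRadial r := by
    intro f g hf hg
    refine integral_eq_sphere_mul_radial fun Ω r hr => ?_
    rw [radialExt_smul_coe g Ω hr, laplacian_radialExt_smul hf Ω hr, cutoffC, cutoff_smul_coe,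
      cutoffRadial]
    push_cast
    ring
  refine mul_right_cancel₀ (integral_cutoffRadial_ne_zero n) ?_
  rw [← hpolar hf hg, ← hpolar hg hf, integral_cutoff_mul_laplacian hf hg,
    integral_cutoff_mul_laplacian hg hf]
  simp only [mul_comm (fderiv ℝ (radialExt f) _ _)]

end Green

/-! ### Which `Y_a` are harmonic functions -/

section Eigenfunctions

variable {n ℓ : ℕ}

lemma contMDiff_Y (a : Tensor n ℓ) : ContMDiff (𝓡 n) 𝓘(ℝ, ℂ) ∞ (Y a) := by
  have := Fact.mk (@finrank_euclideanSpace_fin ℝ _ (n + 1))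
  have h : ContMDiff (𝓡 n) 𝓘(ℝ, Ambient n) ∞ ((↑) : Sph n → Ambient n) :=
    (contMDiff_coe_sphere (m := ω) (n := n) (E := Ambient n)).of_le (by simp)
  exact (contDiff_homPoly a).contMDiff.comp h

lemma laplacian_Y (a : Tensor n ℓ) (p : Sph n) :
    laplacian (Y a) p = Laplacian.laplacian (homPoly a) (p : Ambient n)
      - ((ℓ : ℝ) * (ℓ + n - 1) : ℝ) * Y a p :=
  laplacian_restrict_of_homogeneous p ℓ (contDiff_homPoly a).contDiffAt (homPoly_coe a)
    (Eventually.of_forall fun t => homPoly_smul_arg a t p)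

lemma Y_mem_eigenspace_iff_of_isSymm {a : Tensor n ℓ} (ha : IsSymm a) :
    Y a ∈ eigenspace n ((ℓ : ℝ) * (ℓ + n - 1)) ↔ IsTraceless a := by
  have h : Y a ∈ eigenspace n ((ℓ : ℝ) * (ℓ + n - 1))
      ↔ ∀ p : Sph n, Laplacian.laplacian (homPoly a) (p : Ambient n) = 0 := by
    refine ⟨fun h p => ?_, fun h => ⟨contMDiff_Y a, fun p => ?_⟩⟩
    · have := h.2 p
      rwa [laplacian_Y, sub_add_cancel] at this
    · rw [laplacian_Y, sub_add_cancel, h p]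
  rw [h]
  match ℓ, a, ha with
  | 0, a, _ => exact iff_of_true (fun p => laplacian_homPoly_of_le_one (by norm_num) _) trivial
  | 1, a, _ => exact iff_of_true (fun p => laplacian_homPoly_of_le_one le_rfl _) trivial
  | m + 2, a, ha =>
    rw [isTraceless_iff]
    refine ⟨fun h => eq_zero_of_Y_eq_zero ha.trace fun p => ?_, fun h p => ?_⟩
    · have h1 := h p
      rw [laplacian_homPoly ha] at h1
      have h2 : ((m : ℂ) + 2) * (m + 1) ≠ 0 := by norm_cast
      exact (mul_eq_zero.mp h1).resolve_left h2
    · rw [laplacian_homPoly ha, h, homPoly_zero_tensor]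
      simp

theorem Y_mem_eigenspace_iff (a : Tensor n ℓ) :
    Y a ∈ eigenspace n ((ℓ : ℝ) * (ℓ + n - 1)) ↔ IsTraceless (symmPart a) := by
  rw [← Y_symmPart]
  exact Y_mem_eigenspace_iff_of_isSymm (isSymm_symmPart a)

/-- Harmonic functions for different eigenvalues are orthogonal. -/
lemma integral_mul_eq_zero_of_eigenvalue_ne {k l : ℝ} (hkl : k ≠ l) {f g : Sph n → ℂ}
    (hf : f ∈ eigenspace n k) (hg : g ∈ eigenspace n l) :
    ∫ Ω, g Ω * f Ω ∂surfaceMeasure n = 0 := by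
  have h := integral_mul_laplacian_comm hf.1 hg.1
  have h1 : ∀ Ω, laplacian f Ω = -k * f Ω := fun Ω => by linear_combination hf.2 Ω
  have h2 : ∀ Ω, laplacian g Ω = -l * g Ω := fun Ω => by linear_combination hg.2 Ω
  have e1 : ∀ Ω, g Ω * (-k * f Ω) = -k * (g Ω * f Ω) := fun Ω => by ring
  have e2 : ∀ Ω, f Ω * (-l * g Ω) = -l * (g Ω * f Ω) := fun Ω => by ring
  simp only [h1, h2, e1, e2, integral_const_mul] at h
  have h3 : ((k : ℂ) - l) ≠ 0 := sub_ne_zero.mpr (by exact_mod_cast hkl)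
  refine (mul_eq_zero.mp ?_).resolve_left h3
  linear_combination -h

lemma eigenvalue_injective (hn : 1 ≤ n) {ℓ ℓ' : ℕ}
    (h : (ℓ : ℝ) * (ℓ + n - 1) = (ℓ' : ℝ) * (ℓ' + n - 1)) : ℓ = ℓ' := by
  by_contra hne
  have h1 : ((ℓ : ℝ) - ℓ') * (ℓ + ℓ' + n - 1) = 0 := by linear_combination h
  have h2 : (1 : ℝ) ≤ (ℓ + ℓ' : ℕ) := by exact_mod_cast (by omega : 1 ≤ ℓ + ℓ')
  have h3 : (1 : ℝ) ≤ n := by exact_mod_cast hn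
  push_cast at h2
  rcases mul_eq_zero.mp h1 with h4 | h4
  · exact hne (by exact_mod_cast sub_eq_zero.mp h4)
  · linarith

end Eigenfunctions

/-! ### Completeness -/

section Completeness

variable {n ℓ : ℕ}

/-- The linear map sending a tensor to `Y_a` as a continuous function. -/
def Yₗ (n ℓ : ℕ) : Tensor n ℓ →ₗ[ℂ] C(Sph n, ℂ) where
  toFun a := ⟨Y a, continuous_Y a⟩
  map_add' a b := ContinuousMap.ext fun Ω => congrFun (homPoly_add a b) (Ω : Ambient n)
  map_smul' c a := ContinuousMap.ext fun Ω => congrFun (homPoly_const_smul c a) (Ω : Ambient n)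

/-- The continuous functions spanned by the `Y_a` with symmetric traceless `a`. -/
def harmonicSpan (n : ℕ) : Submodule ℂ C(Sph n, ℂ) := ⨆ ℓ, (harmonicTensors n ℓ).map (Yₗ n ℓ)

lemma Yₗ_mem_harmonicSpan_of_mem {a : Tensor n ℓ} (ha : a ∈ harmonicTensors n ℓ) :
    Yₗ n ℓ a ∈ harmonicSpan n :=
  Submodule.mem_iSup_of_mem ℓ (Submodule.mem_map_of_mem ha)

/-- On the sphere every `Y_a` is a combination of harmonic ones, by repeatedly splitting off the
trace, since `|Ω|² = 1`. -/
lemma Yₗ_mem_harmonicSpan (a : Tensor n ℓ) : Yₗ n ℓ a ∈ harmonicSpan n := by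
  induction ℓ using Nat.strong_induction_on with
  | _ ℓ ih =>
    have h1 : Yₗ n ℓ a = Yₗ n ℓ (symmPart a) :=
      ContinuousMap.ext fun Ω => (congrFun (Y_symmPart a) Ω).symm
    rw [h1]
    have hs := isSymm_symmPart a
    match ℓ, a, hs, ih with
    | 0, a, hs, _ => exact Yₗ_mem_harmonicSpan_of_mem ⟨hs, trivial⟩
    | 1, a, hs, _ => exact Yₗ_mem_harmonicSpan_of_mem ⟨hs, trivial⟩
    | m + 2, a, hs, ih =>
      have h2 : symmPart a ∈ symTensors n (m + 2) := hs
      rw [← (symTensors_splitting n m).2] at h2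
      obtain ⟨h, hh, _, ⟨b, -, rfl⟩, hsum⟩ := Submodule.mem_sup.mp h2
      rw [← hsum, map_add]
      refine add_mem (Yₗ_mem_harmonicSpan_of_mem hh) ?_
      have h3 : Yₗ n (m + 2) (metricProd b) = Yₗ n m b :=
        ContinuousMap.ext fun Ω => congrFun (Y_metricProd b) Ω
      rw [h3]
      exact ih m (by omega) b

/-- The coordinate functions on the sphere. -/
def coordMap (A : Fin (n + 1)) : C(Sph n, ℂ) where
  toFun Ω := (((Ω : Ambient n) A : ℝ) : ℂ)

lemma star_coordMap (A : Fin (n + 1)) : star (coordMap (n := n) A) = coordMap A :=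
  ContinuousMap.ext fun _ => Complex.conj_ofReal _

lemma coordMap_mul_Yₗ (A : Fin (n + 1)) (a : Tensor n ℓ) :
    ∃ b : Tensor n (ℓ + 1), coordMap A * Yₗ n ℓ a = Yₗ n (ℓ + 1) b := by
  refine ⟨fun I => if I 0 = A then a (Fin.tail I) else 0, ContinuousMap.ext fun Ω => ?_⟩
  change (((Ω : Ambient n) A : ℝ) : ℂ) * homPoly a (Ω : Ambient n) = homPoly _ (Ω : Ambient n)
  rw [homPoly_eq_sum_slice, Finset.sum_eq_single A]
  · congr 2
    funext J
    simp [slice]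
  · intro B _ hB
    have : slice (fun I : Fin (ℓ + 1) → Fin (n + 1) => if I 0 = A then a (Fin.tail I) else 0) B
        = 0 := by
      funext J
      simp [slice, hB]
    rw [this, homPoly_zero_tensor]
    simp
  · simp

lemma exists_Yₗ_eq_of_mem_closure {f : C(Sph n, ℂ)}
    (hf : f ∈ Submonoid.closure (Set.range (coordMap (n := n)))) :
    ∃ (ℓ : ℕ) (a : Tensor n ℓ), f = Yₗ n ℓ a := by
  induction hf using Submonoid.closure_induction_left with
  | one =>
    refine ⟨0, fun _ => 1, ContinuousMap.ext fun Ω => ?_⟩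
    exact (homPoly_rank_zero (fun _ => 1) (Ω : Ambient n)).symm
  | mul_left x hx y _ ih =>
    obtain ⟨A, rfl⟩ := hx
    obtain ⟨ℓ, a, rfl⟩ := ih
    obtain ⟨b, hb⟩ := coordMap_mul_Yₗ A a
    exact ⟨ℓ + 1, b, hb⟩

lemma dense_harmonicSpan (n : ℕ) : Dense (harmonicSpan n : Set C(Sph n, ℂ)) := by
  let A : StarSubalgebra ℂ C(Sph n, ℂ) := StarAlgebra.adjoin ℂ (Set.range (coordMap (n := n)))
  have hA : A.topologicalClosure = ⊤ := by
    refine ContinuousMap.starSubalgebra_topologicalClosure_eq_top_of_separatesPoints A ?_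
    intro Ω Ω' hne
    obtain ⟨B, hB⟩ : ∃ B, (Ω : Ambient n) B ≠ (Ω' : Ambient n) B := by
      by_contra! h
      exact hne (Subtype.ext (PiLp.ext h))
    refine ⟨coordMap B, ⟨coordMap B, StarAlgebra.subset_adjoin ℂ _ ⟨B, rfl⟩, rfl⟩, ?_⟩
    exact fun h => hB (Complex.ofReal_injective h)
  have hle : (A : Set C(Sph n, ℂ)) ⊆ harmonicSpan n := by
    intro f hf
    have h1 : f ∈ A.toSubalgebra := hf
    have hstar : star (Set.range (coordMap (n := n))) = Set.range coordMap := by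
      ext g
      constructor
      · rintro ⟨B, hB⟩
        exact ⟨B, by rw [← star_coordMap, hB, star_star]⟩
      · rintro ⟨B, rfl⟩
        exact ⟨B, (star_coordMap B).symm⟩
    rw [StarAlgebra.adjoin_toSubalgebra, hstar, Set.union_self, ← Subalgebra.mem_toSubmodule,
      Algebra.adjoin_eq_span] at h1
    refine Submodule.span_le.mpr ?_ h1
    intro g hg
    obtain ⟨ℓ, a, rfl⟩ := exists_Yₗ_eq_of_mem_closure hg
    exact Yₗ_mem_harmonicSpan a
  have hd : Dense (A : Set C(Sph n, ℂ)) := by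
    rw [dense_iff_closure_eq, ← StarSubalgebra.topologicalClosure_coe, hA]
    rfl
  exact hd.mono hle

/-- The embedding of continuous functions into `L²` of the sphere. -/
abbrev toL2 (n : ℕ) : C(Sph n, ℂ) →L[ℂ] Lp ℂ 2 (surfaceMeasure n) :=
  ContinuousMap.toLp 2 (surfaceMeasure n) ℂ

/-- The linear map `a ↦ Y_a` into `L²` of the sphere. -/
def YL2ₗ (n ℓ : ℕ) : Tensor n ℓ →ₗ[ℂ] Lp ℂ 2 (surfaceMeasure n) :=
  (toL2 n).toLinearMap.comp (Yₗ n ℓ)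

/-- The space of harmonics of rank `ℓ` in `L²` of the sphere. -/
def harmonicL2 (n ℓ : ℕ) : Submodule ℂ (Lp ℂ 2 (surfaceMeasure n)) :=
  (harmonicTensors n ℓ).map (YL2ₗ n ℓ)

instance (n ℓ : ℕ) : FiniteDimensional ℂ (harmonicL2 n ℓ) := by
  unfold harmonicL2
  infer_instance

lemma topologicalClosure_iSup_harmonicL2 (n : ℕ) :
    (⨆ ℓ, harmonicL2 n ℓ).topologicalClosure = ⊤ := by
  have h1 : ⨆ ℓ, harmonicL2 n ℓ = (harmonicSpan n).map (toL2 n).toLinearMap := by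
    simp only [harmonicSpan, Submodule.map_iSup, harmonicL2, YL2ₗ, Submodule.map_comp]
  have h2 : Dense ((toL2 n) '' (harmonicSpan n : Set C(Sph n, ℂ))) :=
    (ContinuousMap.toLp_denseRange ℂ (surfaceMeasure n) ℂ (by norm_num)).dense_image
      (toL2 n).continuous (dense_harmonicSpan n)
  rw [h1, ← Submodule.dense_iff_topologicalClosure_eq_top]
  exact h2

lemma inner_toL2 (f g : C(Sph n, ℂ)) :
    inner ℂ (toL2 n f) (toL2 n g)
      = ∫ Ω, starRingEnd ℂ (f Ω) * g Ω ∂surfaceMeasure n := by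
  rw [ContinuousMap.inner_toLp]
  simp only [mul_comm]

lemma inner_YL2_of_ne {ℓ ℓ' : ℕ} (hne : ℓ ≠ ℓ') {a : Tensor n ℓ} {a' : Tensor n ℓ'}
    (ha : a ∈ harmonicTensors n ℓ) (ha' : a' ∈ harmonicTensors n ℓ') :
    inner ℂ (YL2 a) (YL2 a') = 0 :=
  (inner_toL2 _ _).trans (integral_conj_Y_mul_Y_eq_zero hne ha.1 ha.2 ha'.1 ha'.2)

lemma inner_YL2 {a a' : Tensor n ℓ} (ha : a ∈ harmonicTensors n ℓ)
    (ha' : a' ∈ harmonicTensors n ℓ) :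
    inner ℂ (YL2 a) (YL2 a') = (C n ℓ : ℂ) * contract a a' :=
  (inner_toL2 _ _).trans (integral_conj_Y_mul_Y ha.1 ha.2 ha'.1)

lemma C_ne_zero (n ℓ : ℕ) : (C n ℓ : ℂ) ≠ 0 := by
  have : 0 < Real.Gamma (((n : ℝ) + 1) / 2 + ℓ) := Real.Gamma_pos_of_pos (by positivity)
  have h : 0 < C n ℓ := by
    unfold C
    positivity
  exact_mod_cast h.ne'

lemma eq_zero_of_inner_YL2_self {a : Tensor n ℓ} (ha : a ∈ harmonicTensors n ℓ)
    (h : inner ℂ (YL2 a) (YL2 a) = 0) : a = 0 := by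
  rw [inner_YL2 ha ha] at h
  exact contract_self_eq_zero ((mul_eq_zero.mp h).resolve_left (C_ne_zero n ℓ))

/-- Every `L²` function is a sum of harmonics, by the Hilbert sum decomposition. -/
lemma exists_hasSum_YL2 (f : Lp ℂ 2 (surfaceMeasure n)) :
    ∃ a : (ℓ : ℕ) → Tensor n ℓ, (∀ ℓ, a ℓ ∈ harmonicTensors n ℓ) ∧
      HasSum (fun ℓ => YL2 (a ℓ)) f := by
  have hort : OrthogonalFamily ℂ (fun ℓ => harmonicL2 n ℓ)
      fun ℓ => (harmonicL2 n ℓ).subtypeₗᵢ := by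
    rintro ℓ ℓ' hne ⟨_, a, ha, rfl⟩ ⟨_, a', ha', rfl⟩
    exact inner_YL2_of_ne hne ha ha'
  have hH : IsHilbertSum ℂ (fun ℓ => harmonicL2 n ℓ) fun ℓ => (harmonicL2 n ℓ).subtypeₗᵢ :=
    IsHilbertSum.mkInternal _ hort (topologicalClosure_iSup_harmonicL2 n).ge
  have hs := hH.hasSum_linearIsometryEquiv_symm (hH.linearIsometryEquiv f)
  rw [LinearIsometryEquiv.symm_apply_apply] at hs
  choose a ha hae using fun ℓ => (hH.linearIsometryEquiv f ℓ).2
  refine ⟨a, ha, ?_⟩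
  convert! hs using 2 with ℓ
  exact hae ℓ

/-- The pairing of a series of harmonics with a harmonic of rank `ℓ` sees only the term of
rank `ℓ`. -/
lemma inner_YL2_eq_of_hasSum {a : (ℓ : ℕ) → Tensor n ℓ} (ha : ∀ ℓ, a ℓ ∈ harmonicTensors n ℓ)
    {f : Lp ℂ 2 (surfaceMeasure n)} (hs : HasSum (fun ℓ => YL2 (a ℓ)) f) {b : Tensor n ℓ}
    (hb : b ∈ harmonicTensors n ℓ) : inner ℂ (YL2 b) f = inner ℂ (YL2 b) (YL2 (a ℓ)) :=
  ((innerSL ℂ (YL2 b)).hasSum hs).unique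
    (hasSum_single ℓ fun _ hne => inner_YL2_of_ne hne.symm hb (ha _))

theorem existsUnique_hasSum_YL2 (f : Lp ℂ 2 (surfaceMeasure n)) :
    ∃! a : (ℓ : ℕ) → Tensor n ℓ,
      (∀ ℓ, IsSymm (a ℓ) ∧ IsTraceless (a ℓ)) ∧ HasSum (fun ℓ => YL2 (a ℓ)) f := by
  obtain ⟨a, ha, hs⟩ := exists_hasSum_YL2 f
  refine ⟨a, ⟨ha, hs⟩, ?_⟩
  rintro a' ⟨ha', hs'⟩
  funext ℓ
  have hd : a' ℓ - a ℓ ∈ harmonicTensors n ℓ := sub_mem (ha' ℓ) (ha ℓ)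
  refine sub_eq_zero.mp (eq_zero_of_inner_YL2_self hd ?_)
  have h1 : YL2 (a' ℓ - a ℓ) = YL2 (a' ℓ) - YL2 (a ℓ) := map_sub (YL2ₗ n ℓ) (a' ℓ) (a ℓ)
  nth_rw 2 [h1]
  rw [inner_sub_right, ← inner_YL2_eq_of_hasSum ha hs hd, ← inner_YL2_eq_of_hasSum ha' hs' hd,
    sub_self]

theorem topologicalClosure_span_YL2 (n : ℕ) :
    (Submodule.span ℂ {g : Lp ℂ 2 (surfaceMeasure n) |
      ∃ (ℓ : ℕ) (a : Tensor n ℓ), IsSymm a ∧ IsTraceless a ∧ YL2 a = g}).topologicalClosure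
        = ⊤ := by
  rw [eq_top_iff, ← topologicalClosure_iSup_harmonicL2 n]
  refine Submodule.topologicalClosure_mono (iSup_le fun ℓ => ?_)
  rintro _ ⟨a, ha, rfl⟩
  exact Submodule.subset_span ⟨ℓ, a, ha.1, ha.2, rfl⟩

end Completeness

/-! ### Multiplicities -/

section Multiplicity

variable {n : ℕ}

/-- A harmonic function with eigenvalue `ℓ (ℓ + n - 1)` is orthogonal to all `Y_b` of other ranks,
so its expansion reduces to a single term. -/
lemma exists_Y_eq_of_mem_eigenspace (hn : 1 ≤ n) {ℓ : ℕ} {f : Sph n → ℂ}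
    (hf : f ∈ eigenspace n ((ℓ : ℝ) * (ℓ + n - 1))) :
    ∃ a ∈ harmonicTensors n ℓ, Y a = f := by
  let F : C(Sph n, ℂ) := ⟨f, hf.1.continuous⟩
  obtain ⟨a, ha, hs⟩ := exists_hasSum_YL2 (toL2 n F)
  have h0 : ∀ ℓ', ℓ' ≠ ℓ → a ℓ' = 0 := fun ℓ' hne => by
    refine eq_zero_of_inner_YL2_self (ha ℓ') ?_
    rw [← inner_YL2_eq_of_hasSum ha hs (ha ℓ')]
    refine (inner_toL2 _ _).trans ?_
    change ∫ Ω, starRingEnd ℂ (Y (a ℓ') Ω) * f Ω ∂surfaceMeasure n = 0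
    simp only [conj_Y]
    exact integral_mul_eq_zero_of_eigenvalue_ne (fun h => hne (eigenvalue_injective hn h).symm) hf
      ((Y_mem_eigenspace_iff_of_isSymm (ha ℓ').1.conj).mpr (ha ℓ').2.conj)
  have h1 : toL2 n F = YL2 (a ℓ) := hs.unique (hasSum_single ℓ fun ℓ' hne => by
    rw [h0 ℓ' hne]
    exact map_zero (YL2ₗ n ℓ'))
  refine ⟨a ℓ, ha ℓ, ?_⟩
  have h2 : F = Yₗ n ℓ (a ℓ) := ContinuousMap.toLp_injective (surfaceMeasure n) h1
  exact (congrArg (fun g : C(Sph n, ℂ) => (g : Sph n → ℂ)) h2).symm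

theorem finrank_eigenspace (hn : 1 ≤ n) (ℓ : ℕ) :
    finrank ℂ (eigenspace n ((ℓ : ℝ) * (ℓ + n - 1))) = finrank ℂ (harmonicTensors n ℓ) := by
  let T : harmonicTensors n ℓ →ₗ[ℂ] eigenspace n ((ℓ : ℝ) * (ℓ + n - 1)) :=
    { toFun := fun a => ⟨Y (a : Tensor n ℓ), (Y_mem_eigenspace_iff_of_isSymm a.2.1).mpr a.2.2⟩
      map_add' := fun a b => Subtype.ext
        (funext fun Ω => congrFun (homPoly_add (a : Tensor n ℓ) b) (Ω : Ambient n))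
      map_smul' := fun c a => Subtype.ext
        (funext fun Ω => congrFun (homPoly_const_smul c (a : Tensor n ℓ)) (Ω : Ambient n)) }
  have hT : Function.Bijective T := by
    constructor
    · rw [← LinearMap.ker_eq_bot, LinearMap.ker_eq_bot']
      intro a h
      exact Subtype.ext (eq_zero_of_Y_eq_zero a.2.1
        fun Ω => congrFun (congrArg Subtype.val h) Ω)
    · rintro ⟨f, hf⟩
      obtain ⟨a, ha, rfl⟩ := exists_Y_eq_of_mem_eigenspace hn hf
      exact ⟨⟨a, ha⟩, rfl⟩
  exact (LinearEquiv.ofBijective T hT).finrank_eq.symm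

end Multiplicity

end SphereHarmonics
end

theorem mainTheorem7 (n : ℕ) (hn : 1 ≤ n) :
    -- 1) characterization of the harmonic functions `Y_a`
    (∀ (ℓ : ℕ) (a : SphereHarmonics.Tensor n ℓ),
      SphereHarmonics.IsSymm (SphereHarmonics.symmPart a) ∧
      SphereHarmonics.Y (SphereHarmonics.symmPart a) = SphereHarmonics.Y a ∧
      (SphereHarmonics.Y a ∈ SphereHarmonics.eigenspace n ((ℓ : ℝ) * (ℓ + n - 1)) ↔
        SphereHarmonics.IsTraceless (SphereHarmonics.symmPart a)) ∧
      (SphereHarmonics.IsSymm a →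
        (SphereHarmonics.Y a ∈ SphereHarmonics.eigenspace n ((ℓ : ℝ) * (ℓ + n - 1)) ↔
          SphereHarmonics.IsTraceless a))) ∧
    -- 2) completeness in `L²`
    (Submodule.span ℂ {g : Lp ℂ 2 (SphereHarmonics.surfaceMeasure n) |
        ∃ (ℓ : ℕ) (a : SphereHarmonics.Tensor n ℓ),
          SphereHarmonics.IsSymm a ∧ SphereHarmonics.IsTraceless a ∧
          SphereHarmonics.YL2 a = g}).topologicalClosure = ⊤ ∧
    (∀ f : Lp ℂ 2 (SphereHarmonics.surfaceMeasure n),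
      ∃! a : (ℓ : ℕ) → SphereHarmonics.Tensor n ℓ,
        (∀ ℓ, SphereHarmonics.IsSymm (a ℓ) ∧ SphereHarmonics.IsTraceless (a ℓ)) ∧
        HasSum (fun ℓ => SphereHarmonics.YL2 (a ℓ)) f) ∧
    -- orthogonality for different `ℓ`
    (∀ (ℓ ℓ' : ℕ) (a : SphereHarmonics.Tensor n ℓ) (a' : SphereHarmonics.Tensor n ℓ'),
      ℓ ≠ ℓ' →
      SphereHarmonics.IsSymm a → SphereHarmonics.IsTraceless a →
      SphereHarmonics.IsSymm a' → SphereHarmonics.IsTraceless a' →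
      ∫ Ω, starRingEnd ℂ (SphereHarmonics.Y a Ω) * SphereHarmonics.Y a' Ω
        ∂(SphereHarmonics.surfaceMeasure n) = 0) ∧
    -- inner product for equal `ℓ`
    (∀ (ℓ : ℕ) (a a' : SphereHarmonics.Tensor n ℓ),
      SphereHarmonics.IsSymm a → SphereHarmonics.IsTraceless a →
      SphereHarmonics.IsSymm a' → SphereHarmonics.IsTraceless a' →
      ∫ Ω, starRingEnd ℂ (SphereHarmonics.Y a Ω) * SphereHarmonics.Y a' Ω
        ∂(SphereHarmonics.surfaceMeasure n)
          = (SphereHarmonics.C n ℓ : ℂ) * SphereHarmonics.contract a a') ∧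
    -- 3) multiplicity
    (∀ ℓ : ℕ, 2 ≤ n + ℓ →
      (Module.finrank ℂ (SphereHarmonics.eigenspace n ((ℓ : ℝ) * (ℓ + n - 1))) : ℝ)
        = ((n : ℝ) + 2 * ℓ - 1) * (n + ℓ - 2) ! / ((n - 1) ! * ℓ !)) ∧
    (n = 1 → Module.finrank ℂ (SphereHarmonics.eigenspace n 0) = 1) := by
  refine ⟨fun ℓ a => ⟨SphereHarmonics.isSymm_symmPart a, SphereHarmonics.Y_symmPart a,
      SphereHarmonics.Y_mem_eigenspace_iff a, SphereHarmonics.Y_mem_eigenspace_iff_of_isSymm⟩,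
    SphereHarmonics.topologicalClosure_span_YL2 n,
    SphereHarmonics.existsUnique_hasSum_YL2,
    fun ℓ ℓ' a a' hne ha ht ha' ht' =>
      SphereHarmonics.integral_conj_Y_mul_Y_eq_zero hne ha ht ha' ht',
    fun ℓ a a' ha ht ha' _ => SphereHarmonics.integral_conj_Y_mul_Y ha ht ha',
    fun ℓ h => ?_, ?_⟩
  · rw [SphereHarmonics.finrank_eigenspace hn]
    exact SphereHarmonics.finrank_harmonicTensors hn ℓ h
  · rintro rfl
    have h := SphereHarmonics.finrank_eigenspace le_rfl 0
    rw [SphereHarmonics.finrank_harmonicTensors_of_le_one 1 (by norm_num)] at h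
    have e : ((0 : ℕ) : ℝ) * ((0 : ℕ) + (1 : ℕ) - 1) = 0 := by simp
    rw [e] at h
    simpa using h
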